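/- Let $\Lambda=\mathbb{Z}\omega_1\oplus\mathbb{Z}\omega_2\subset\mathbb{C}$ be a lattice ($\omega_1,\omega_2$ linearly independent over $\mathbb{R}$), let $T=\mathbb{C}/\Lambda$ be the corresponding complex torus, and let $\mathrm{Aut}(T)$ be the group of all biholomorphic maps $T\to T$ (not necessarily fixing $0$). Let $\mathrm{Aut}(\mathfrak{sl}_2)$ be the group of Lie algebra automorphisms of $\mathfrak{sl}_2(\mathbb{C})$, and let $g_2(\Lambda)=60\sum_{0\ne\omega\in\Lambda}\omega^{-4}$; in particular, $g_2(\mathbb{Z}\oplus\mathbb{Z}\tau)=g_2(\tau)$ for $\operatorname{Im}\tau>0$. Say that a group $G$ embeds in a group $H$ if there is an injective group homomorphism $G\to H$. Then: 1. A finite group $G$ embeds both in $\mathrm{Aut}(\mathfrak{sl}_2)$ and in $\mathrm{Aut}(T)$ if and only if one of the following holds: $G$ is isomorphic to the cyclic group $C_N$ of order $N$ for some $N\ge 1$; $G$ is isomorphic to the dihedral group $D_N$ of order $2N$ for some $N\ge 2$ (with $D_2=C_2\times C_2$); or $G$ is isomorphic to the alternating group $A_4$ and $g_2(\Lambda)=0$.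 2. Neither the symmetric group $S_4$ nor the alternating group $A_5$ embeds in $\mathrm{Aut}(T)$. 3. The commutator subgroup $[\mathrm{Aut}(T),\mathrm{Aut}(T)]$ is equal to the group $\{z\mapsto z+a : a\in T\}$ of translations of $T$. -/

import Mathlib

open scoped Manifold ContDiff Topology

noncomputable section

/-! ### The automorphism group of a Lie algebra -/

/-- The Lie algebra automorphisms of `𝔤` form a group under composition. -/
instance LieEquiv.instGroupAut {R : Type*} {𝔤 : Type*} [CommRing R] [LieRing 𝔤]
    [LieAlgebra R 𝔤] : Group (𝔤 ≃ₗ⁅R⁆ 𝔤) where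
  mul f g := g.trans f
  one := LieEquiv.refl
  inv f := f.symm
  mul_assoc _ _ _ := rfl
  one_mul _ := rfl
  mul_one _ := rfl
  inv_mul_cancel f := by
    ext x
    exact f.symm_apply_apply x

/-- `Aut(𝔰𝔩₂)`, where `𝔰𝔩₂ = 𝔰𝔩₂(ℂ)` is the Lie algebra of traceless complex `2 × 2` matrices. -/
abbrev AutSl2 : Type :=
  LieAlgebra.SpecialLinear.sl (Fin 2) ℂ ≃ₗ⁅ℂ⁆ LieAlgebra.SpecialLinear.sl (Fin 2) ℂ

/-! ### The automorphism group of a Riemann surface -/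

/-- The group of biholomorphisms of a Riemann surface `X`: the homeomorphisms of `X` that are
holomorphic (complex differentiable in charts) together with their inverse. -/
def Biholomorphisms (X : Type*) [TopologicalSpace X] [ChartedSpace ℂ X] :
    Subgroup (X ≃ₜ X) where
  carrier := {f | MDifferentiable 𝓘(ℂ) 𝓘(ℂ) (f : X → X) ∧
    MDifferentiable 𝓘(ℂ) 𝓘(ℂ) (f.symm : X → X)}
  mul_mem' hf hg := ⟨hf.1.comp hg.1, hg.2.comp hf.2⟩
  one_mem' := ⟨mdifferentiable_id, mdifferentiable_id⟩
  inv_mem' hf := ⟨hf.2, hf.1⟩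

/-! ### Complex tori -/

namespace PeriodPair

/-- The complex torus `ℂ / Λ`, where `Λ = ℤω₁ ⊕ ℤω₂` is the lattice of the period pair. -/
abbrev Torus (L : PeriodPair) : Type := ℂ ⧸ L.lattice.toAddSubgroup

/-- The projection `ℂ → ℂ / Λ`. -/
abbrev toTorus (L : PeriodPair) : ℂ → L.Torus := QuotientAddGroup.mk

theorem toTorus_isLocalHomeomorph (L : PeriodPair) : IsLocalHomeomorph L.toTorus :=
  (AddSubgroup.isAddQuotientCoveringMap_of_comm L.lattice.toAddSubgroup
    (isDiscrete_iff_discreteTopology.mpr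
      (inferInstanceAs (DiscreteTopology L.lattice)))).isCoveringMap.isLocalHomeomorph

theorem toTorus_surjective (L : PeriodPair) : Function.Surjective L.toTorus :=
  QuotientAddGroup.mk_surjective

/-- The complex structure of `ℂ / Λ`: its charts are local inverses of the projection from `ℂ`. -/
instance instChartedSpaceTorus (L : PeriodPair) : ChartedSpace ℂ L.Torus :=
  L.toTorus_isLocalHomeomorph.chartedSpace L.toTorus_surjective

/-- Changes of charts are locally translations by lattice vectors. -/
instance instIsManifoldTorus (L : PeriodPair) : IsManifold 𝓘(ℂ) ω L.Torus := by
  apply isManifold_of_contDiffOn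
  rintro _ _ ⟨p, rfl⟩ ⟨q, rfl⟩
  set hL := L.toTorus_isLocalHomeomorph
  set z := L.toTorus_surjective.hasRightInverse.choose p
  set z' := L.toTorus_surjective.hasRightInverse.choose q
  set e := (hL.localInverseAt z).trans (.refl ℂ) with he
  set e' := (hL.localInverseAt z').trans (.refl ℂ) with he'
  have hsymm (w : ℂ) : e.symm w = L.toTorus w := by simp [he]
  have hinv (t : L.Torus) (ht : t ∈ e'.source) : L.toTorus (e' t) = t := by
    have ht' : t ∈ (hL.localInverseAt z').source := by simpa [he'] using ht
    simpa [he'] using hL.apply_localInverseAt_of_mem ht'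
  have key : ContDiffOn ℂ ω (fun w ↦ e' (L.toTorus w)) (e.symm.trans e').source := by
    intro w hw
    have hopen : (e.symm.trans e').source ∈ 𝓝 w := (e.symm.trans e').open_source.mem_nhds hw
    have hcont : ContinuousAt (fun w ↦ e' (L.toTorus w)) w := by
      have := (e.symm.trans e').continuousAt hw
      simpa [Function.comp_def, hsymm] using this
    have hmem (v : ℂ) (hv : v ∈ (e.symm.trans e').source) :
        e' (L.toTorus v) - v ∈ L.lattice := by
      have hv' : L.toTorus v ∈ e'.source := by
        have := hv.2
        simpa [hsymm] using this
      have h := QuotientAddGroup.eq.mp (hinv _ hv').symm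
      rwa [neg_add_eq_sub] at h
    obtain ⟨U, hU, hU0⟩ : ∃ U ∈ 𝓝 (0 : ℂ), ∀ l ∈ U, l ∈ L.lattice → l = 0 := by
      have h0 : ({0} : Set L.lattice) ∈ 𝓝 (0 : L.lattice) := by simp
      rw [nhds_subtype] at h0
      obtain ⟨U, hU, h⟩ := h0
      exact ⟨U, hU, fun l hl hl' ↦ congrArg Subtype.val (h (a := ⟨l, hl'⟩) hl)⟩
    have hev : (fun v ↦ e' (L.toTorus v)) =ᶠ[𝓝 w] fun v ↦ v + (e' (L.toTorus w) - w) := by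
      have ht : Filter.Tendsto (fun v ↦ (e' (L.toTorus v) - v) - (e' (L.toTorus w) - w))
          (𝓝 w) (𝓝 0) := by
        have h := (hcont.tendsto.sub (Filter.tendsto_id (x := 𝓝 w))).sub_const
          (e' (L.toTorus w) - w)
        simpa only [id, sub_self] using h
      filter_upwards [ht hU, hopen] with v hv hv'
      have := hU0 _ hv (sub_mem (hmem v hv') (hmem w hw))
      linear_combination this
    exact ((contDiffAt_id.add contDiffAt_const).congr_of_eventuallyEq hev).contDiffWithinAt
  have hfun : (𝓘(ℂ) ∘ (e.symm.trans e') ∘ 𝓘(ℂ).symm : ℂ → ℂ) = fun w ↦ e' (L.toTorus w) := by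
    ext w
    simp [hsymm]
  have hset : (𝓘(ℂ).symm ⁻¹' (e.symm.trans e').source ∩ Set.range 𝓘(ℂ) : Set ℂ)
      = (e.symm.trans e').source := by
    simp
  rw [← hset, ← hfun] at key
  exact key

/-- The group `t(T)` of translations `z ↦ z + a` of the torus `T`, as a subgroup of `Aut(T)`. -/
def translations (L : PeriodPair) : Subgroup (Biholomorphisms L.Torus) where
  carrier := {f | ∃ a : L.Torus, ∀ z : L.Torus, (f : L.Torus ≃ₜ L.Torus) z = z + a}
  mul_mem' := by
    rintro f g ⟨a, ha⟩ ⟨b, hb⟩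
    refine ⟨b + a, fun z ↦ ?_⟩
    change (f : L.Torus ≃ₜ L.Torus) ((g : L.Torus ≃ₜ L.Torus) z) = _
    rw [hb, ha, add_assoc]
  one_mem' := ⟨0, fun z ↦ (add_zero z).symm⟩
  inv_mem' := by
    rintro f ⟨a, ha⟩
    refine ⟨-a, fun z ↦ ?_⟩
    change (f : L.Torus ≃ₜ L.Torus).symm z = _
    rw [Homeomorph.symm_apply_eq, ha, neg_add_cancel_right]

end PeriodPair

/-- The group `G` embeds in the group `H`. -/
def EmbedsIn (G H : Type*) [Group G] [Group H] : Prop :=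
  ∃ φ : G →* H, Function.Injective φ

end

noncomputable section

/-! ### Embeddings of dihedral groups and of `A₄` -/

/-! Both automorphism groups are made explicit, and a finite group lying in both is squeezed between
them; the full classification of finite subgroups of `PGL₂(ℂ)` is not needed.

On the Lie algebra side, automorphisms preserve an invariant quadratic form and are conjugations
(`Sl2.Ad_surjective`), so a nontrivial one of finite order fixes a nonisotropic vector `h`, its axis
(`Sl2.exists_isAxis`). The stabilizer of `h` embeds in `ℂˣ`, and an automorphism with `h ↦ -h` is an
involution inverting that stabilizer. Hence a finite group preserving an axis up to sign is cyclic
or dihedral, and an elementary abelian 2-group has order at most 4 (`Sl2.card_le_four`).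

On the torus side, lifting to `ℂ` and Liouville's theorem make every automorphism affine, `z ↦ ζz +
b` (`PeriodPair.exists_affine`). The linear part `ζ` is a homomorphism to `ℂˣ` with the abelian
group of translations as kernel; on a finite group `ζ` has order 1, 2, 3, 4 or 6.

Let a finite `G` lie in both, and let `A` be its abelian normal subgroup of translations. If some `b
∈ A` has `b² ≠ 1`, then `G` preserves the axis of `b` up to sign. Otherwise `A` is an elementary
abelian 2-group. If `|A| ≤ 2`, then `A` is central with cyclic quotient, and `G` is abelian. In the
remaining nonabelian case `|A| = 4`. A linear part `-1` would enlarge `A` to an elementary abelian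
2-group of order above 4, so all linear parts are cube roots of unity, `|G| = 12`, and a subgroup of
order 3 is not normal: `G ≅ A₄`. The lattice then admits multiplication by a primitive cube root of
unity, which forces `g₂ = 0`.

Conversely, translations and `z ↦ -z` realise the cyclic and dihedral groups. If `g₂ = 0`, the
differential equation determines `℘` and has a symmetry of order 3, so the pole set of `℘` is stable
under cube roots of unity (`PeriodPair.mul_mem_lattice_of_g₂_eq_zero`); rotation and half-period
translations then generate `A₄`. Commutators in `Aut(T)` are translations and so commute, which
excludes `S₄` and `A₅`. -/

theorem MonoidHom.embedsIn {G H : Type*} [Group G] [Group H] (φ : G →* H)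
    (hφ : Function.Injective φ) : EmbedsIn G H := ⟨φ, hφ⟩

theorem MulEquiv.embedsIn {G G' H : Type*} [Group G] [Group G'] [Group H] (e : G ≃* G')
    (h : EmbedsIn G' H) : EmbedsIn G H := by
  obtain ⟨φ, hφ⟩ := h
  exact ⟨φ.comp e.toMonoidHom, hφ.comp e.injective⟩

/-- A homomorphism from a dihedral group is given by a homomorphism from the rotation subgroup and
an involution inverting its values. -/
def dihedralLift {H : Type*} [Group H] {N : ℕ} (θ : Multiplicative (ZMod N) →* H) (s : H)
    (hs : s * s = 1) (h : ∀ x, s * θ x * s⁻¹ = (θ x)⁻¹) : DihedralGroup N →* H where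
  toFun
    | .r i => θ (.ofAdd i)
    | .sr i => s * θ (.ofAdd i)
  map_one' := θ.map_one
  map_mul' := by
    have hs' : s⁻¹ = s := inv_eq_of_mul_eq_one_right hs
    have key (i j : ZMod N) : θ (.ofAdd (j - i)) = (θ (.ofAdd i))⁻¹ * θ (.ofAdd j) := by
      rw [sub_eq_neg_add, ofAdd_add, map_mul, ofAdd_neg, map_inv]
    have hc (x) : θ x * s = s * (θ x)⁻¹ := by
      rw [← h x, hs']; simp only [hs, ← mul_assoc, one_mul]
    rintro (i | i) (j | j)
    · simp [ofAdd_add]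
    · simp only [DihedralGroup.r_mul_sr, key]
      rw [← mul_assoc, ← hc, mul_assoc]
    · simp [ofAdd_add, mul_assoc]
    · simp only [DihedralGroup.sr_mul_sr, key]
      rw [mul_assoc, ← mul_assoc (θ _) s, hc, mul_assoc, ← mul_assoc s s, hs, one_mul]

theorem dihedralLift_injective {H : Type*} [Group H] {N : ℕ} {θ : Multiplicative (ZMod N) →* H}
    {s : H} (hs : s * s = 1) (h : ∀ x, s * θ x * s⁻¹ = (θ x)⁻¹) (hθ : Function.Injective θ)
    (hsθ : s ∉ θ.range) : Function.Injective (dihedralLift θ s hs h) := by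
  rw [injective_iff_map_eq_one]
  rintro (i | i) hi
  · have : Multiplicative.ofAdd i = 1 := hθ (by rw [map_one]; exact hi)
    exact congrArg DihedralGroup.r this
  · refine absurd ⟨(.ofAdd i)⁻¹, ?_⟩ hsθ
    rw [map_inv]
    exact (eq_inv_of_mul_eq_one_left hi).symm

/-- A finite cyclic subgroup together with an involution inverting it generates a dihedral group. -/
theorem exists_dihedral_hom_injective {H : Type*} [Group H] (C : Subgroup H) [Finite C]
    (hC : IsCyclic C) {s : H} (hsC : s ∉ C) (hs : s * s = 1)
    (h : ∀ c ∈ C, s * c * s⁻¹ = c⁻¹) :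
    EmbedsIn (DihedralGroup (Nat.card C)) H := by
  set e := zmodCyclicMulEquiv hC
  have hinv (x) : s * (C.subtype.comp e.toMonoidHom) x * s⁻¹
      = ((C.subtype.comp e.toMonoidHom) x)⁻¹ := h _ (e x).2
  refine ⟨dihedralLift _ s hs hinv, dihedralLift_injective hs hinv
    (C.subtype_injective.comp e.injective) ?_⟩
  rintro ⟨x, rfl⟩
  exact hsC (e x).2

/-- A finite group with a cyclic subgroup of index `2` that is inverted by an involution outside
it is dihedral. -/
theorem nonempty_mulEquiv_dihedral {G : Type*} [Group G] [Finite G] (C : Subgroup G)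
    (hC : IsCyclic C) (hi : C.index = 2) {s : G} (hsC : s ∉ C) (hs : s * s = 1)
    (h : ∀ c ∈ C, s * c * s⁻¹ = c⁻¹) :
    Nonempty (G ≃* DihedralGroup (Nat.card C)) := by
  obtain ⟨φ, hφ⟩ := exists_dihedral_hom_injective C hC hsC hs h
  have hcard : Nat.card (DihedralGroup (Nat.card C)) = Nat.card G := by
    rw [DihedralGroup.nat_card, ← C.card_mul_index, hi, mul_comm]
  have : NeZero (Nat.card C) := ⟨Nat.card_pos.ne'⟩
  exact ⟨(MulEquiv.ofBijective φ
    ((Nat.bijective_iff_injective_and_card φ).mpr ⟨hφ, hcard⟩)).symm⟩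

/-- A group of order `12` with a non-normal subgroup of order `3` is isomorphic to `A₄`. -/
theorem nonempty_mulEquiv_alternatingGroup_four {G : Type*} [Group G] (hG : Nat.card G = 12)
    (P : Subgroup G) (hP : Nat.card P = 3) (hn : ¬ P.Normal) :
    Nonempty (G ≃* alternatingGroup (Fin 4)) := by
  have : Finite G := Nat.finite_of_card_ne_zero (by omega)
  have hidx : Nat.card (G ⧸ P) = 4 := by
    have h := P.card_mul_index
    rw [hG, hP] at h
    have : P.index = 4 := by omega
    exact this
  have : Fact (Nat.Prime 3) := ⟨Nat.prime_three⟩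
  -- The core is the kernel of the action on the four cosets of `P`. Its order divides 3 and it is
  -- not `P`, so `G` embeds in `S₄` with index 2.
  have hcore : P.normalCore = ⊥ := by
    have hle := P.normalCore_le
    have hdvd := Subgroup.card_dvd_of_le hle
    rw [hP, Nat.dvd_prime Nat.prime_three] at hdvd
    rcases hdvd with h | h
    · exact Subgroup.card_eq_one.mp h
    · have : P.normalCore = P := Subgroup.eq_of_le_of_card_ge hle (by rw [h, hP])
      exact absurd (this ▸ P.normalCore_normal) hn
  rw [Subgroup.normalCore_eq_ker] at hcore
  let e : G ⧸ P ≃ Fin 4 := (Finite.equivFinOfCardEq hidx)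
  let φ : G →* Equiv.Perm (Fin 4) :=
    (e.permCongrHom : Equiv.Perm (G ⧸ P) →* Equiv.Perm (Fin 4)).comp (MulAction.toPermHom G (G ⧸ P))
  have hφ : Function.Injective φ :=
    e.permCongrHom.injective.comp ((MonoidHom.ker_eq_bot_iff _).mp hcore)
  have hr : Nat.card φ.range = 12 := by
    rw [← hG]; exact (Nat.card_congr (MonoidHom.ofInjective hφ).toEquiv).symm
  have hri : φ.range.index = 2 := by
    have h := φ.range.card_mul_index
    rw [hr, Nat.card_perm, Nat.card_fin] at h
    have h4 : Nat.factorial 4 = 24 := rfl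
    omega
  rw [← Equiv.Perm.eq_alternatingGroup_of_index_eq_two hri]
  exact ⟨MonoidHom.ofInjective hφ⟩

/-- The subgroup `{1, a, b, ab}` generated by two commuting involutions. -/
def kleinSubgroup {H : Type*} [Group H] (a b : H) (ha : a * a = 1) (hb : b * b = 1)
    (hab : a * b = b * a) : Subgroup H where
  carrier := {1, a, b, a * b}
  one_mem' := by simp
  mul_mem' := by
    have h1 : a * (a * b) = b := by rw [← mul_assoc, ha, one_mul]
    have h2 : b * (a * b) = a := by rw [hab, ← mul_assoc, hb, one_mul]
    have h3 : a * b * a = b := by rw [hab, mul_assoc, ha, mul_one]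
    have h4 : a * b * b = a := by rw [mul_assoc, hb, mul_one]
    have h5 : a * b * (a * b) = 1 := by rw [mul_assoc, h2, ha]
    rintro x y (rfl | rfl | rfl | rfl) (rfl | rfl | rfl | rfl) <;>
      simp [ha, hb, h1, h2, h3, h4, h5, ← hab]
  inv_mem' := by
    have ha' : a⁻¹ = a := inv_eq_of_mul_eq_one_right ha
    have hb' : b⁻¹ = b := inv_eq_of_mul_eq_one_right hb
    rintro x (rfl | rfl | rfl | rfl) <;> simp [ha', hb', ← hab]

theorem card_kleinSubgroup {H : Type*} [Group H] {a b : H} (ha : a * a = 1) (hb : b * b = 1)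
    (hab : a * b = b * a) (ha1 : a ≠ 1) (hb1 : b ≠ 1) (hne : a ≠ b) :
    Nat.card (kleinSubgroup a b ha hb hab) = 4 := by
  have h : Nat.card (kleinSubgroup a b ha hb hab) = Set.ncard {1, a, b, a * b} := rfl
  have hab1 : a * b ≠ 1 := fun h ↦ hne (by
    rw [← inv_eq_of_mul_eq_one_right hb]; exact eq_inv_of_mul_eq_one_left h)
  rw [h, Set.ncard_insert_of_notMem (by simp [ha1.symm, hb1.symm, hab1.symm]),
    Set.ncard_insert_of_notMem (by simp [hne, hb1]), Set.ncard_pair (by simp [ha1])]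

/-- If an element of order `3` permutes three commuting involutions cyclically, then they generate
a copy of `A₄`. -/
theorem embedsIn_alternatingGroup_four {H : Type*} [Group H] {a b g : H} (ha : a * a = 1)
    (ha1 : a ≠ 1) (hne : a ≠ b) (hab : a * b = b * a) (hg : g ^ 3 = 1)
    (hga : g * a * g⁻¹ = b) (hgb : g * b * g⁻¹ = a * b) :
    EmbedsIn (alternatingGroup (Fin 4)) H := by
  have hb : b * b = 1 := by
    rw [← hga]; simp only [mul_assoc, inv_mul_cancel_left]
    rw [← mul_assoc a a, ha, one_mul, mul_inv_cancel]
  have hb1 : b ≠ 1 := by rintro rfl; exact ha1 (by simpa using hga)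
  have hg1 : g ≠ 1 := by rintro rfl; exact hne (by simpa using hga)
  have hord : orderOf g = 3 := orderOf_eq_prime hg hg1
  set V := kleinSubgroup a b ha hb hab with hV
  have hV4 : Nat.card V = 4 := card_kleinSubgroup ha hb hab ha1 hb1 hne
  have hP3 : Nat.card (Subgroup.zpowers g) = 3 := by rw [Nat.card_zpowers, hord]
  have hgV : g ∈ Subgroup.normalizer (V : Set H) := by
    have hle : V.map (MulAut.conj g).toMonoidHom ≤ V := by
      rw [Subgroup.map_le_iff_le_comap]
      rintro x (rfl | rfl | rfl | rfl)
      · simp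
      · change g * x * g⁻¹ ∈ V
        rw [hga]; simp [hV, kleinSubgroup, ← SetLike.mem_coe]
      · change g * x * g⁻¹ ∈ V
        rw [hgb]; simp [hV, kleinSubgroup, ← SetLike.mem_coe]
      · change g * (a * b) * g⁻¹ ∈ V
        have : g * (a * b) * g⁻¹ = (g * a * g⁻¹) * (g * b * g⁻¹) := by group
        rw [this, hga, hgb, hab, ← mul_assoc, hb, one_mul]
        simp [hV, kleinSubgroup, ← SetLike.mem_coe]
    have : Finite V := Nat.finite_of_card_ne_zero (by omega)
    have heq : V.map (MulAut.conj g).toMonoidHom = V :=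
      Subgroup.eq_of_le_of_card_ge hle
        (Subgroup.card_map_of_injective (MulAut.conj g).injective).ge
    exact Subgroup.mem_normalizer_iff_map_conj_eq.mpr heq
  have hle : Subgroup.zpowers g ≤ Subgroup.normalizer (V : Set H) := by simpa using hgV
  have hdisj : V ⊓ Subgroup.zpowers g = ⊥ :=
    (Subgroup.disjoint_of_coprime_natCard (by rw [hV4, hP3]; decide)).eq_bot
  -- `V` and `⟨g⟩` have coprime orders, so their semidirect product of order 12 maps injectively to
  -- `H`; it remains to recognise it as `A₄`.
  set S := V ⋊[(V.normalizerMonoidHom).comp (Subgroup.inclusion hle)] Subgroup.zpowers g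
  have hinj : Function.Injective (SemidirectProduct.monoidHomSubgroup hle) := by
    rw [injective_iff_map_eq_one]
    rintro ⟨x, y⟩ hxy
    have hxy' : (x : H) * y = 1 := by simpa using hxy
    have hy : (y : H) = 1 := by
      have : (y : H) ∈ V ⊓ Subgroup.zpowers g := by
        refine ⟨?_, y.2⟩
        rw [← inv_eq_of_mul_eq_one_right hxy']
        exact V.inv_mem x.2
      rw [hdisj] at this
      simpa using this
    have hx : (x : H) = 1 := by simpa [hy] using hxy'
    ext <;> simp [hx, hy]
  have hS : Nat.card S = 12 := by rw [SemidirectProduct.card, hV4, hP3]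
  set P : Subgroup S := (SemidirectProduct.inr : _ →* S).range
  have hPc : Nat.card P = 3 := by
    rw [← hP3]
    exact (Nat.card_congr (MonoidHom.ofInjective SemidirectProduct.inr_injective).toEquiv).symm
  have haV : a ∈ V := by simp [hV, kleinSubgroup, ← SetLike.mem_coe]
  have hPn : ¬ P.Normal := by
    intro hn
    have hgP : SemidirectProduct.inr ⟨g, Subgroup.mem_zpowers g⟩ ∈ P := ⟨_, rfl⟩
    obtain ⟨y, hy⟩ := hn.conj_mem _ hgP (SemidirectProduct.inl ⟨a, haV⟩)
    have h := congrArg (SemidirectProduct.monoidHomSubgroup hle) hy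
    rw [map_mul, map_mul, map_inv] at h
    simp only [SemidirectProduct.monoidHomSubgroup, SemidirectProduct.lift_inr,
      SemidirectProduct.lift_inl, Subgroup.subtype_apply] at h
    -- If `⟨g⟩` were normal, the commutator of `a` and `g`, which is `a * b`, would lie in both
    -- `⟨g⟩` and `V`.
    have hyg : (y : H) * g⁻¹ = a * b := by
      rw [h, inv_eq_of_mul_eq_one_right ha, ← hga]; group
    have : a * b ∈ V ⊓ Subgroup.zpowers g := by
      refine ⟨by simp [hV, kleinSubgroup], ?_⟩
      rw [← hyg]
      exact (Subgroup.zpowers g).mul_mem y.2 (inv_mem (Subgroup.mem_zpowers g))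
    rw [hdisj] at this
    have h1 : a * b = 1 := by simpa using this
    exact hne ((eq_inv_of_mul_eq_one_left h1).trans (inv_eq_of_mul_eq_one_right hb))
  obtain ⟨e⟩ := nonempty_mulEquiv_alternatingGroup_four hS P hPc hPn
  exact e.symm.embedsIn ⟨_, hinj⟩

/-! ### Recognising cyclic and dihedral groups -/

/-- The cyclic and dihedral groups. -/
def IsCyclicOrDihedral (G : Type*) [Group G] : Prop :=
  (∃ N : ℕ, 1 ≤ N ∧ Nonempty (G ≃* Multiplicative (ZMod N))) ∨
    (∃ N : ℕ, 2 ≤ N ∧ Nonempty (G ≃* DihedralGroup N))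

theorem IsCyclic.isCyclicOrDihedral {G : Type*} [Group G] [Finite G] (h : IsCyclic G) :
    IsCyclicOrDihedral G :=
  .inl ⟨Nat.card G, Nat.card_pos, ⟨(zmodCyclicMulEquiv h).symm⟩⟩

/-- A group of exponent `2` and order at most `4` is cyclic or a Klein four-group. -/
theorem isCyclicOrDihedral_of_mul_self {G : Type*} [Group G] [Finite G]
    (h : ∀ x : G, x * x = 1) (hG : Nat.card G ≤ 4) : IsCyclicOrDihedral G := by
  have hpos : 0 < Nat.card G := Nat.card_pos
  obtain h1 | h1 | h1 | h1 : Nat.card G = 1 ∨ Nat.card G = 2 ∨ Nat.card G = 3 ∨ Nat.card G = 4 := by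
    omega
  · have := (Nat.card_eq_one_iff_unique.mp h1).1
    exact IsCyclic.isCyclicOrDihedral inferInstance
  · have : Fact (Nat.Prime 2) := ⟨Nat.prime_two⟩
    exact (isCyclic_of_prime_card h1).isCyclicOrDihedral
  · have : Fact (Nat.Prime 3) := ⟨Nat.prime_three⟩
    exact (isCyclic_of_prime_card h1).isCyclicOrDihedral
  · have : IsKleinFour G := by
      refine ⟨h1, ?_⟩
      have hd : Monoid.exponent G ∣ 2 :=
        Monoid.exponent_dvd_of_forall_pow_eq_one fun x ↦ by rw [pow_two, h]
      rcases (Nat.dvd_prime Nat.prime_two).mp hd with h0 | h0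
      · have := Monoid.exp_eq_one_iff.mp h0
        rw [Nat.card_of_subsingleton (1 : G)] at h1
        omega
      · exact h0
    exact .inr ⟨2, le_rfl, IsKleinFour.nonempty_mulEquiv⟩

/-! ### Automorphisms of `𝔰𝔩₂(ℂ)` -/

namespace Sl2

open LieAlgebra.SpecialLinear Matrix

theorem mem_iff {X : Matrix (Fin 2) (Fin 2) ℂ} : X ∈ sl (Fin 2) ℂ ↔ Matrix.trace X = 0 := Iff.rfl

/-- The traceless matrix `!![a, b; c, -a]`. -/
def mk (a b c : ℂ) : sl (Fin 2) ℂ :=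
  ⟨!![a, b; c, -a], mem_iff.mpr (by simp [Matrix.trace_fin_two])⟩

theorem val_one_one (x : sl (Fin 2) ℂ) : x.val 1 1 = -x.val 0 0 := by
  have h : Matrix.trace x.val = 0 := x.2
  rw [Matrix.trace_fin_two] at h
  linear_combination h

theorem eq_mk (x : sl (Fin 2) ℂ) : x = mk (x.val 0 0) (x.val 0 1) (x.val 1 0) := by
  apply Subtype.ext
  ext i j
  fin_cases i <;> fin_cases j <;> simp [mk, val_one_one]

theorem mk_inj {a b c a' b' c' : ℂ} : mk a b c = mk a' b' c' ↔ a = a' ∧ b = b' ∧ c = c' := by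
  constructor
  · intro h
    have h' := congrArg Subtype.val h
    exact ⟨congrFun₂ h' 0 0, congrFun₂ h' 0 1, congrFun₂ h' 1 0⟩
  · rintro ⟨rfl, rfl, rfl⟩; rfl

theorem smul_mk (t a b c : ℂ) : t • mk a b c = mk (t * a) (t * b) (t * c) := by
  apply Subtype.ext
  ext i j
  fin_cases i <;> fin_cases j <;> simp [mk]

theorem add_mk (a b c a' b' c' : ℂ) : mk a b c + mk a' b' c' = mk (a + a') (b + b') (c + c') := by
  apply Subtype.ext
  ext i j
  fin_cases i <;> fin_cases j <;> simp [mk, add_comm]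

theorem neg_mk (a b c : ℂ) : -mk a b c = mk (-a) (-b) (-c) := by
  apply Subtype.ext
  ext i j
  fin_cases i <;> fin_cases j <;> simp [mk]

theorem mk_zero : mk 0 0 0 = 0 := by
  apply Subtype.ext
  ext i j
  fin_cases i <;> fin_cases j <;> simp [mk]

theorem lie_mk (a b c a' b' c' : ℂ) : ⁅mk a b c, mk a' b' c'⁆ =
    mk (b * c' - b' * c) (2 * (a * b' - a' * b)) (2 * (c * a' - c' * a)) := by
  apply Subtype.ext
  rw [sl_bracket]
  ext i j
  fin_cases i <;> fin_cases j <;> simp [mk] <;> ring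

/-- The semisimple element of the standard basis. -/
def H : sl (Fin 2) ℂ := mk 1 0 0

/-- The raising element of the standard basis. -/
def E : sl (Fin 2) ℂ := mk 0 1 0

/-- The lowering element of the standard basis. -/
def F : sl (Fin 2) ℂ := mk 0 0 1

theorem mk_eq (a b c : ℂ) : mk a b c = a • H + b • E + c • F := by
  simp [H, E, F, smul_mk, add_mk]

theorem mul_apply (f g : AutSl2) (x : sl (Fin 2) ℂ) : (f * g) x = f (g x) := rfl

theorem inv_apply_self (f : AutSl2) (x : sl (Fin 2) ℂ) : f⁻¹ (f x) = x :=
  f.symm_apply_apply x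

theorem apply_inv_self (f : AutSl2) (x : sl (Fin 2) ℂ) : f (f⁻¹ x) = x :=
  f.apply_symm_apply x

theorem aut_ext {f g : AutSl2} (hH : f H = g H) (hE : f E = g E) (hF : f F = g F) : f = g := by
  ext1 x
  rw [eq_mk x, mk_eq]
  simp [hH, hE, hF]

/-! #### The invariant bilinear form -/

/-- The invariant bilinear form, normalised by `x * x = form x x • 1`. -/
def form (x y : sl (Fin 2) ℂ) : ℂ :=
  x.val 0 0 * y.val 0 0 + (x.val 0 1 * y.val 1 0 + x.val 1 0 * y.val 0 1) / 2

theorem form_mk (a b c a' b' c' : ℂ) :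
    form (mk a b c) (mk a' b' c') = a * a' + (b * c' + c * b') / 2 := rfl

/-- Matrix multiplication is recovered from the form and the bracket; this is why an automorphism of
the Lie algebra extends to the matrix algebra. -/
theorem val_mul_val (x y : sl (Fin 2) ℂ) :
    x.val * y.val = form x y • (1 : Matrix (Fin 2) (Fin 2) ℂ) + (1 / 2 : ℂ) • ⁅x, y⁆.val := by
  rw [sl_bracket, eq_mk x, eq_mk y, form_mk]
  ext i j
  fin_cases i <;> fin_cases j <;> simp [mk, Matrix.mul_apply, Fin.sum_univ_two] <;> ring

/-- This expresses the form through brackets alone, so automorphisms must preserve it. -/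
theorem lie_lie_lie (x y : sl (Fin 2) ℂ) : ⁅x, ⁅x, ⁅x, y⁆⁆⁆ = (4 * form x x) • ⁅x, y⁆ := by
  rw [eq_mk x, eq_mk y, form_mk]
  simp only [lie_mk, smul_mk, mk_inj]
  refine ⟨?_, ?_, ?_⟩ <;> ring

theorem eq_zero_of_forall_lie {x : sl (Fin 2) ℂ} (h : ∀ y : sl (Fin 2) ℂ, ⁅x, y⁆ = 0) : x = 0 := by
  have h1 := h H
  have h2 := h E
  rw [eq_mk x] at h1 h2 ⊢
  simp only [H, E, lie_mk, ← mk_zero, mk_inj] at h1 h2 ⊢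
  obtain ⟨-, h3, h4⟩ := h1
  obtain ⟨-, h5, -⟩ := h2
  refine ⟨?_, ?_, ?_⟩
  · linear_combination h5 / 2
  · linear_combination -h3 / 2
  · linear_combination h4 / 2

/-- Applying `φ` to `lie_lie_lie` gives the same identity for `φ x`; the coefficients can be
compared on a nonzero bracket, since the centre is trivial. -/
theorem form_self_map (φ : AutSl2) (x : sl (Fin 2) ℂ) : form (φ x) (φ x) = form x x := by
  rcases eq_or_ne x 0 with rfl | hx
  · rw [map_zero]
  obtain ⟨y, hy⟩ : ∃ y : sl (Fin 2) ℂ, ⁅x, y⁆ ≠ 0 := by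
    by_contra! h
    exact hx (eq_zero_of_forall_lie h)
  have h := congrArg φ (lie_lie_lie x y)
  simp only [LieEquiv.map_lie, map_smul] at h
  rw [lie_lie_lie, ← LieEquiv.map_lie] at h
  have hy' : φ ⁅x, y⁆ ≠ 0 := by simpa using hy
  have := smul_left_injective ℂ hy' h
  linear_combination this / 4

theorem form_add_self (x y : sl (Fin 2) ℂ) :
    form (x + y) (x + y) = form x x + 2 * form x y + form y y := by
  rw [eq_mk x, eq_mk y, add_mk, form_mk, form_mk, form_mk, form_mk]; ring

theorem form_map (φ : AutSl2) (x y : sl (Fin 2) ℂ) : form (φ x) (φ y) = form x y := by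
  have h := form_self_map φ (x + y)
  rw [map_add, form_add_self, form_add_self, form_self_map, form_self_map] at h
  linear_combination h / 2

/-! #### Automorphisms are inner -/

/-- Half the trace. -/
def scalarPart (X : Matrix (Fin 2) (Fin 2) ℂ) : ℂ := (X 0 0 + X 1 1) / 2

/-- The traceless part of a matrix. -/
def tracelessPart (X : Matrix (Fin 2) (Fin 2) ℂ) : sl (Fin 2) ℂ :=
  mk ((X 0 0 - X 1 1) / 2) (X 0 1) (X 1 0)

theorem eq_scalarPart_add (X : Matrix (Fin 2) (Fin 2) ℂ) :
    X = scalarPart X • (1 : Matrix (Fin 2) (Fin 2) ℂ) + (tracelessPart X).val := by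
  ext i j
  fin_cases i <;> fin_cases j <;> simp [scalarPart, tracelessPart, mk] <;> ring

theorem scalarPart_val (x : sl (Fin 2) ℂ) : scalarPart x.val = 0 := by
  simp [scalarPart, val_one_one]

theorem tracelessPart_val (x : sl (Fin 2) ℂ) : tracelessPart x.val = x := by
  conv_rhs => rw [eq_mk x]
  simp [tracelessPart, val_one_one]

theorem scalarPart_mul (X Y : Matrix (Fin 2) (Fin 2) ℂ) : scalarPart (X * Y) =
    scalarPart X * scalarPart Y + form (tracelessPart X) (tracelessPart Y) := by
  simp only [tracelessPart, form_mk, scalarPart, Matrix.mul_apply, Fin.sum_univ_two]; ring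

theorem tracelessPart_mul (X Y : Matrix (Fin 2) (Fin 2) ℂ) : tracelessPart (X * Y) =
    scalarPart X • tracelessPart Y + scalarPart Y • tracelessPart X
      + (1 / 2 : ℂ) • ⁅tracelessPart X, tracelessPart Y⁆ := by
  simp only [tracelessPart, lie_mk, smul_mk, add_mk, mk_inj, scalarPart, Matrix.mul_apply,
    Fin.sum_univ_two]
  refine ⟨?_, ?_, ?_⟩ <;> ring

/-- The extension of an automorphism of `𝔰𝔩₂` to an endomorphism of the algebra of `2 × 2`
matrices. -/
def extend (φ : AutSl2) : Matrix (Fin 2) (Fin 2) ℂ →ₐ[ℂ] Matrix (Fin 2) (Fin 2) ℂ :=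
  AlgHom.ofLinearMap
    { toFun X := scalarPart X • (1 : Matrix (Fin 2) (Fin 2) ℂ) + (φ (tracelessPart X)).val
      map_add' X Y := by
        have h1 : scalarPart (X + Y) = scalarPart X + scalarPart Y := by
          simp only [scalarPart, Matrix.add_apply]; ring
        have h2 : tracelessPart (X + Y) = tracelessPart X + tracelessPart Y := by
          simp only [tracelessPart, add_mk, mk_inj, Matrix.add_apply]
          refine ⟨?_, ?_, ?_⟩ <;> first | trivial | ring
        rw [h1, h2, map_add, add_smul]
        change _ + ((φ (tracelessPart X)).val + (φ (tracelessPart Y)).val) = _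
        abel
      map_smul' t X := by
        have h1 : scalarPart (t • X) = t * scalarPart X := by
          simp only [scalarPart, Matrix.smul_apply, smul_eq_mul]; ring
        have h2 : tracelessPart (t • X) = t • tracelessPart X := by
          simp only [tracelessPart, smul_mk, mk_inj, Matrix.smul_apply, smul_eq_mul]
          refine ⟨?_, ?_, ?_⟩ <;> first | trivial | ring
        rw [h1, h2, map_smul, mul_smul, RingHom.id_apply, smul_add]
        rfl }
    (by
      have h : tracelessPart 1 = 0 := by simp [tracelessPart, mk_zero]
      change scalarPart 1 • (1 : Matrix (Fin 2) (Fin 2) ℂ) + (φ (tracelessPart 1)).val = 1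
      rw [h, map_zero]
      simp [scalarPart])
    (by
      intro X Y
      change scalarPart (X * Y) • (1 : Matrix (Fin 2) (Fin 2) ℂ) + (φ (tracelessPart (X * Y))).val
        = (scalarPart X • (1 : Matrix (Fin 2) (Fin 2) ℂ) + (φ (tracelessPart X)).val) *
          (scalarPart Y • (1 : Matrix (Fin 2) (Fin 2) ℂ) + (φ (tracelessPart Y)).val)
      rw [scalarPart_mul, tracelessPart_mul, add_mul, mul_add, mul_add, val_mul_val, form_map]
      simp only [map_add, map_smul, LieEquiv.map_lie]
      change _ + (scalarPart X • (φ (tracelessPart Y)).val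
        + scalarPart Y • (φ (tracelessPart X)).val
        + (1 / 2 : ℂ) • ⁅φ (tracelessPart X), φ (tracelessPart Y)⁆.val) = _
      simp only [smul_mul_assoc, mul_smul_comm, one_mul, mul_one]
      module)

theorem extend_val (φ : AutSl2) (x : sl (Fin 2) ℂ) : extend φ x.val = (φ x).val := by
  change scalarPart x.val • (1 : Matrix (Fin 2) (Fin 2) ℂ) + (φ (tracelessPart x.val)).val = _
  rw [scalarPart_val, tracelessPart_val, zero_smul, zero_add]

/-- Conjugation by an invertible matrix. -/
def Ad : (Matrix (Fin 2) (Fin 2) ℂ)ˣ →* AutSl2 where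
  toFun P :=
    { toFun x := ⟨P.val * x.val * P⁻¹.val, by
        rw [mem_iff, Matrix.trace_mul_comm, ← mul_assoc, P.inv_mul, one_mul]
        exact x.2⟩
      map_add' x y := Subtype.ext (by simp [mul_add, add_mul])
      map_smul' t x := Subtype.ext (by simp)
      map_lie' {x y} := Subtype.ext (by
        simp only [sl_bracket, mul_sub, sub_mul]
        congr 1 <;> simp only [mul_assoc, Units.inv_mul_cancel_left])
      invFun x := ⟨P⁻¹.val * x.val * P.val, by
        rw [mem_iff, Matrix.trace_mul_comm, ← mul_assoc, P.mul_inv, one_mul]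
        exact x.2⟩
      left_inv x := Subtype.ext (by simp [mul_assoc])
      right_inv x := Subtype.ext (by simp [mul_assoc]) }
  map_one' := by
    ext1 x
    apply Subtype.ext
    change (1 : (Matrix (Fin 2) (Fin 2) ℂ)ˣ).val * x.val * (1⁻¹ : (Matrix (Fin 2) (Fin 2) ℂ)ˣ).val
      = x.val
    simp
  map_mul' P Q := by
    ext1 x
    apply Subtype.ext
    change (P * Q).val * x.val * (P * Q)⁻¹.val = P.val * (Q.val * x.val * Q⁻¹.val) * P⁻¹.val
    simp [mul_assoc]

theorem val_Ad_apply (P : (Matrix (Fin 2) (Fin 2) ℂ)ˣ) (x : sl (Fin 2) ℂ) :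
    (Ad P x).val = P.val * x.val * P⁻¹.val := rfl

theorem Ad_apply_eq_iff {P : (Matrix (Fin 2) (Fin 2) ℂ)ˣ} {x y : sl (Fin 2) ℂ} :
    Ad P x = y ↔ P.val * x.val = y.val * P.val := by
  rw [Subtype.ext_iff, val_Ad_apply]
  exact Units.mul_inv_eq_iff_eq_mul P

/-- Every automorphism of `𝔰𝔩₂(ℂ)` is conjugation by an invertible matrix. -/
theorem Ad_surjective : Function.Surjective Ad := by
  intro φ
  -- The matrix algebra is simple, so the extension is injective, hence bijective by dimension.
  -- Automorphisms of an endomorphism algebra are conjugations, and the conjugating map gives the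
  -- matrix `P`.
  have hinj : Function.Injective (extend φ) := (extend φ).toRingHom.injective
  have hbij : Function.Bijective (extend φ) :=
    ⟨hinj, (LinearMap.injective_iff_surjective (f := (extend φ).toLinearMap)).mp hinj⟩
  let e : Matrix (Fin 2) (Fin 2) ℂ ≃ₐ[ℂ] Module.End ℂ (Fin 2 → ℂ) := Matrix.toLinAlgEquiv'
  obtain ⟨T, hT⟩ := LinearEquiv.conjAlgEquiv_surjective ℂ (Fin 2 → ℂ) (Fin 2 → ℂ)
    ((e.symm.trans (AlgEquiv.ofBijective (extend φ) hbij)).trans e)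
  let P : (Matrix (Fin 2) (Fin 2) ℂ)ˣ :=
    ⟨e.symm T.toLinearMap, e.symm T.symm.toLinearMap, by
      rw [← map_mul, ← map_one e.symm]; congr 1; ext; simp, by
      rw [← map_mul, ← map_one e.symm]; congr 1; ext; simp⟩
  refine ⟨P, ?_⟩
  ext1 x
  rw [Ad_apply_eq_iff, ← extend_val]
  apply e.injective
  have h := DFunLike.congr_fun hT (e x.val)
  have h' : (T.toLinearMap ∘ₗ e x.val ∘ₗ T.symm.toLinearMap : Module.End ℂ (Fin 2 → ℂ))
    = e (extend φ x.val) := by simpa [LinearEquiv.conjAlgEquiv_apply] using h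
  rw [map_mul, map_mul, ← h']
  simp only [P, AlgEquiv.apply_symm_apply]
  ext v
  simp

/-! #### Axes of automorphisms of finite order -/

/-- The subgroup of automorphisms fixing a given element. -/
def stab (h : sl (Fin 2) ℂ) : Subgroup AutSl2 where
  carrier := {φ | φ h = h}
  one_mem' := rfl
  mul_mem' {φ ψ} hφ hψ := by
    change φ (ψ h) = h
    rw [show ψ h = h from hψ, show φ h = h from hφ]
  inv_mem' {φ} hφ := by
    change φ⁻¹ h = h
    conv_lhs => rw [← show φ h = h from hφ]
    exact inv_apply_self φ h

theorem mem_stab {h : sl (Fin 2) ℂ} {φ : AutSl2} : φ ∈ stab h ↔ φ h = h := Iff.rfl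

/-- The properties of a nonisotropic line that describe its stabilizer in `Aut(𝔰𝔩₂)`. -/
structure IsAxis (h : sl (Fin 2) ℂ) : Prop where
  ne_zero : h ≠ 0
  map_eq_or : ∀ φ ψ : AutSl2, φ h = h → φ ≠ 1 → φ (ψ h) = ψ h → ψ h = h ∨ ψ h = -h
  mul_self : ∀ ψ : AutSl2, ψ h = -h → ψ * ψ = 1
  conj : ∀ φ ψ : AutSl2, φ h = h → ψ h = -h → ψ * φ * ψ⁻¹ = φ⁻¹
  exists_char : ∃ χ : stab h →* ℂˣ, Function.Injective χ

/-- The map preserves the eigenspaces of `ad H`, and `⁅E, F⁆ = H` makes the two scalars reciprocal.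
-/
theorem exists_of_map_H {ψ : AutSl2} (h : ψ H = H) :
    ∃ c : ℂ, c ≠ 0 ∧ ψ E = c • E ∧ ψ F = c⁻¹ • F := by
  have hE : ⁅H, ψ E⁆ = (2 : ℂ) • ψ E := by
    have : ⁅H, E⁆ = (2 : ℂ) • E := by simp [H, E, lie_mk, smul_mk]
    rw [← map_smul, ← this, LieEquiv.map_lie, h]
  have hF : ⁅H, ψ F⁆ = (-2 : ℂ) • ψ F := by
    have : ⁅H, F⁆ = (-2 : ℂ) • F := by
      simp [H, F, lie_mk, smul_mk, -neg_smul]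
    rw [← map_smul, ← this, LieEquiv.map_lie, h]
  have hEF : ⁅ψ E, ψ F⁆ = H := by
    have : ⁅E, F⁆ = H := by simp [H, E, F, lie_mk]
    rw [← LieEquiv.map_lie, this, h]
  obtain ⟨a, b, c, hE'⟩ : ∃ a b c, ψ E = mk a b c := ⟨_, _, _, eq_mk _⟩
  obtain ⟨a', b', c', hF'⟩ : ∃ a b c, ψ F = mk a b c := ⟨_, _, _, eq_mk _⟩
  rw [hE'] at hE hEF ⊢
  rw [hF'] at hF hEF ⊢
  simp only [H, E, F, lie_mk, smul_mk, mk_inj] at *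
  obtain ⟨h1, -, h3⟩ := hE
  obtain ⟨h4, h5, -⟩ := hF
  have ha : a = 0 := by linear_combination -h1 / 2
  have hc : c = 0 := by linear_combination -h3 / 4
  have ha' : a' = 0 := by linear_combination h4 / 2
  have hb' : b' = 0 := by linear_combination h5 / 4
  subst ha hc ha' hb'
  have hbc : b * c' = 1 := by linear_combination hEF.1
  have hb : b ≠ 0 := left_ne_zero_of_mul_eq_one hbc
  refine ⟨b, hb, by simp, by simp, by simp, ?_⟩
  rw [mul_one]; exact eq_inv_of_mul_eq_one_right hbc

/-- Reversing `H` exchanges the eigenlines of `ad H`. -/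
theorem exists_of_map_H_neg {ψ : AutSl2} (h : ψ H = -H) :
    ∃ c : ℂ, c ≠ 0 ∧ ψ E = c • F ∧ ψ F = c⁻¹ • E := by
  have hE : -⁅H, ψ E⁆ = (2 : ℂ) • ψ E := by
    have : ⁅H, E⁆ = (2 : ℂ) • E := by simp [H, E, lie_mk, smul_mk]
    rw [← map_smul, ← this, LieEquiv.map_lie, h, neg_lie]
  have hF : -⁅H, ψ F⁆ = (-2 : ℂ) • ψ F := by
    have : ⁅H, F⁆ = (-2 : ℂ) • F := by
      simp [H, F, lie_mk, smul_mk, -neg_smul]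
    rw [← map_smul, ← this, LieEquiv.map_lie, h, neg_lie]
  have hEF : ⁅ψ E, ψ F⁆ = -H := by
    have : ⁅E, F⁆ = H := by simp [H, E, F, lie_mk]
    rw [← LieEquiv.map_lie, this, h]
  obtain ⟨a, b, c, hE'⟩ : ∃ a b c, ψ E = mk a b c := ⟨_, _, _, eq_mk _⟩
  obtain ⟨a', b', c', hF'⟩ : ∃ a b c, ψ F = mk a b c := ⟨_, _, _, eq_mk _⟩
  rw [hE'] at hE hEF ⊢
  rw [hF'] at hF hEF ⊢
  simp only [H, E, F, lie_mk, smul_mk, neg_mk, mk_inj] at *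
  obtain ⟨h1, h2, -⟩ := hE
  obtain ⟨h4, -, h5⟩ := hF
  have ha : a = 0 := by linear_combination -h1 / 2
  have hb : b = 0 := by linear_combination -h2 / 4
  have ha' : a' = 0 := by linear_combination h4 / 2
  have hc' : c' = 0 := by linear_combination h5 / 4
  subst ha hb ha' hc'
  have hbc : c * b' = 1 := by linear_combination -hEF.1
  have hb : c ≠ 0 := left_ne_zero_of_mul_eq_one hbc
  refine ⟨c, hb, by simp, by simp, ?_, by simp⟩
  rw [mul_one]; exact eq_inv_of_mul_eq_one_right hbc

theorem eq_one_iff_of_map_H {ψ : AutSl2} (h : ψ H = H) : ψ = 1 ↔ ψ E = E := by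
  constructor
  · rintro rfl; rfl
  · intro hE
    obtain ⟨c, hc, h1, h2⟩ := exists_of_map_H h
    have : c = 1 := by
      rw [h1] at hE
      simpa [E, smul_mk, mk_inj] using hE
    subst this
    exact aut_ext h hE (by simpa using h2)

/-- The character by which the stabilizer of `H` acts on the root space of `E`. -/
def charH : stab H →* ℂˣ :=
  MonoidHom.toHomUnits
    { toFun φ := ((φ : AutSl2) E).val 0 1
      map_one' := show E.val 0 1 = 1 by simp [E, mk]
      map_mul' φ ψ := by
        obtain ⟨c, -, h1, -⟩ := exists_of_map_H φ.2
        obtain ⟨d, -, h2, -⟩ := exists_of_map_H ψ.2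
        rw [Subgroup.coe_mul, mul_apply, h2, map_smul, h1]
        simp [E, mk, mul_comm] }

theorem charH_injective : Function.Injective charH := by
  rw [injective_iff_map_eq_one]
  intro φ hφ
  obtain ⟨c, -, h1, -⟩ := exists_of_map_H φ.2
  have h : ((φ : AutSl2) E).val 0 1 = 1 := congrArg Units.val hφ
  apply Subtype.ext
  refine (eq_one_iff_of_map_H φ.2).mpr ?_
  rw [h1] at h ⊢
  have : c = 1 := by simpa [E, mk, smul_mk] using h
  rw [this, one_smul]

theorem H_ne_zero : H ≠ 0 := by
  rw [H, ← mk_zero, Ne, mk_inj]; simp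

theorem isAxis_H : IsAxis H where
  ne_zero := H_ne_zero
  map_eq_or φ ψ hφ hφ1 hψ := by
    obtain ⟨c, hc, h1, h2⟩ := exists_of_map_H hφ
    have hc1 : c ≠ 1 := by
      rintro rfl
      exact hφ1 ((eq_one_iff_of_map_H hφ).mpr (by simpa using h1))
    obtain ⟨x, y, z, hxyz⟩ : ∃ x y z, ψ H = mk x y z := ⟨_, _, _, eq_mk _⟩
    rw [hxyz] at hψ
    have hφ' : φ (mk x y z) = mk x (c * y) (c⁻¹ * z) := by
      rw [mk_eq, map_add, map_add, map_smul, map_smul, map_smul, hφ, h1, h2]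
      simp [H, E, F, smul_mk, add_mk, mul_comm]
    rw [hφ', mk_inj] at hψ
    have hy : y = 0 := by
      have : (c - 1) * y = 0 := by linear_combination hψ.2.1
      exact (mul_eq_zero.mp this).resolve_left (sub_ne_zero.mpr hc1)
    have hz : z = 0 := by
      have h3 := hψ.2.2
      field_simp at h3
      have : (c - 1) * z = 0 := by linear_combination -h3
      exact (mul_eq_zero.mp this).resolve_left (sub_ne_zero.mpr hc1)
    subst hy hz
    -- So far `ψ H` is a multiple of `H`; invariance of the form leaves only `±H`.
    have hform := form_self_map ψ H
    rw [hxyz, H, form_mk, form_mk] at hform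
    have hx : x * x = 1 := by linear_combination hform
    rw [hxyz, H, neg_mk, mk_inj, mk_inj]
    rcases mul_self_eq_one_iff.mp hx with h | h <;> simp [h]
  mul_self ψ hψ := by
    obtain ⟨c, hc, h1, h2⟩ := exists_of_map_H_neg hψ
    refine aut_ext ?_ ?_ ?_
    · rw [mul_apply, hψ, map_neg, hψ, neg_neg]; rfl
    · rw [mul_apply, h1, map_smul, h2, smul_smul, mul_inv_cancel₀ hc, one_smul]; rfl
    · rw [mul_apply, h2, map_smul, h1, smul_smul, inv_mul_cancel₀ hc, one_smul]; rfl
  conj φ ψ hφ hψ := by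
    obtain ⟨c, hc, h1, h2⟩ := exists_of_map_H hφ
    obtain ⟨d, hd, h3, h4⟩ := exists_of_map_H_neg hψ
    rw [mul_inv_eq_iff_eq_mul, eq_inv_mul_iff_mul_eq]
    refine aut_ext ?_ ?_ ?_
    · simp only [mul_apply, hφ, hψ, map_neg]
    · simp only [mul_apply, h1, h2, h3, map_smul, smul_smul]
      congr 1; field_simp
    · simp only [mul_apply, h1, h2, h4, map_smul, smul_smul]
      congr 1; field_simp
  exists_char := ⟨charH, charH_injective⟩

theorem IsAxis.map {h : sl (Fin 2) ℂ} (hh : IsAxis h) (g : AutSl2) : IsAxis (g h) := by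
  have key (φ : AutSl2) (k : sl (Fin 2) ℂ) : (g⁻¹ * φ * g) h = k ↔ φ (g h) = g k := by
    rw [mul_apply, mul_apply]
    constructor
    · intro h1; rw [← h1, apply_inv_self]
    · intro h1; rw [h1, inv_apply_self]
  refine ⟨?_, ?_, ?_, ?_, ?_⟩
  · simpa using hh.ne_zero
  · intro φ ψ h1 h2 h3
    have := hh.map_eq_or (g⁻¹ * φ * g) (g⁻¹ * ψ * g) ((key _ _).mpr h1) (by
      intro h4
      apply h2
      have : φ = g * (g⁻¹ * φ * g) * g⁻¹ := by group
      rw [this, h4]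
      exact (congrArg (· * g⁻¹) (mul_one g)).trans (mul_inv_cancel g)) (by
      simp only [mul_apply, apply_inv_self, h3])
    rwa [key, key, map_neg] at this
  · intro ψ h1
    have := hh.mul_self (g⁻¹ * ψ * g) ((key _ _).mpr (by rw [h1, map_neg]))
    have h2 : ψ * ψ = g * ((g⁻¹ * ψ * g) * (g⁻¹ * ψ * g)) * g⁻¹ := by group
    rw [h2, this]
    exact (congrArg (· * g⁻¹) (mul_one g)).trans (mul_inv_cancel g)
  · intro φ ψ h1 h2
    have := hh.conj (g⁻¹ * φ * g) (g⁻¹ * ψ * g) ((key _ _).mpr h1)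
      ((key _ _).mpr (by rw [h2, map_neg]))
    have h3 : ψ * φ * ψ⁻¹ =
        g * ((g⁻¹ * ψ * g) * (g⁻¹ * φ * g) * (g⁻¹ * ψ * g)⁻¹) * g⁻¹ := by group
    rw [h3, this]; group
  · obtain ⟨χ, hχ⟩ := hh.exists_char
    let c : stab (g h) →* stab h :=
      ((MulAut.conj g⁻¹).toMonoidHom.comp (stab (g h)).subtype).codRestrict (stab h) (by
        intro φ
        have := (key φ h).mpr φ.2
        simpa using! this)
    refine ⟨χ.comp c, hχ.comp ?_⟩
    intro φ ψ h1
    exact Subtype.ext ((MulAut.conj g⁻¹).injective (congrArg Subtype.val h1))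

/-- A normalised nonisotropic element is conjugate to the standard semisimple element. -/
theorem exists_map_H_eq {h : sl (Fin 2) ℂ} (hh : form h h = 1) : ∃ g : AutSl2, g H = h := by
  obtain ⟨p, q, r, rfl⟩ : ∃ p q r, h = mk p q r := ⟨_, _, _, eq_mk _⟩
  rw [form_mk] at hh
  have hh' : p * p + q * r = 1 := by linear_combination hh
  -- The columns of `P` are eigenvectors of `h` for the eigenvalues `1` and `-1`; the upper right
  -- entry `q` may vanish, which needs separate formulas.
  suffices ∃ P : Matrix (Fin 2) (Fin 2) ℂ, P.det ≠ 0 ∧ P * H.val = (mk p q r).val * P by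
    obtain ⟨P, hP, hPH⟩ := this
    have hu : IsUnit P := (Matrix.isUnit_iff_isUnit_det P).mpr (isUnit_iff_ne_zero.mpr hP)
    exact ⟨Ad hu.unit, Ad_apply_eq_iff.mpr hPH⟩
  by_cases hq : q = 0
  · subst hq
    have hp : p * p = 1 := by linear_combination hh'
    rcases mul_self_eq_one_iff.mp hp with rfl | rfl
    · refine ⟨!![2, 0; r, 1], by simp [Matrix.det_fin_two], ?_⟩
      ext i j
      fin_cases i <;> fin_cases j <;> simp [H, mk]; ring
    · refine ⟨!![0, 2; 1, -r], by simp [Matrix.det_fin_two], ?_⟩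
      ext i j
      fin_cases i <;> fin_cases j <;> simp [H, mk] ; ring
  · refine ⟨!![q, q; 1 - p, -1 - p], ?_, ?_⟩
    · rw [Matrix.det_fin_two_of]
      have : q * (-1 - p) - q * (1 - p) = -2 * q := by ring
      rw [this]
      simpa using hq
    · ext i j
      fin_cases i <;> fin_cases j <;> simp [H, mk]
      · ring
      · ring
      · linear_combination -hh'
      · linear_combination -hh'

theorem isAxis_of_form_self_eq_one {h : sl (Fin 2) ℂ} (hh : form h h = 1) : IsAxis h := by
  obtain ⟨g, rfl⟩ := exists_map_H_eq hh
  exact isAxis_H.map g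

/-- An isotropic traceless matrix squares to zero, so the binomial expansion stops after the linear
term. -/
theorem val_pow_of_isotropic {t : ℂ} {N : sl (Fin 2) ℂ} (hN : form N N = 0) (n : ℕ) :
    (t • (1 : Matrix (Fin 2) (Fin 2) ℂ) + N.val) ^ (n + 1) =
      t ^ (n + 1) • (1 : Matrix (Fin 2) (Fin 2) ℂ) + ((n + 1) * t ^ n) • N.val := by
  have hNN : N.val * N.val = 0 := by
    rw [val_mul_val, hN, lie_self]; simp
  induction n with
  | zero => simp
  | succ n ih =>
    rw [pow_succ, ih, add_mul, mul_add, mul_add]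
    simp only [smul_mul_assoc, mul_smul_comm, one_mul, mul_one, hNN, smul_zero, add_zero]
    push_cast
    module

theorem val_Ad_pow (P : (Matrix (Fin 2) (Fin 2) ℂ)ˣ) {n : ℕ} (h : Ad P ^ n = 1)
    (x : sl (Fin 2) ℂ) : P.val ^ n * x.val = x.val * P.val ^ n := by
  rw [← map_pow] at h
  have := Ad_apply_eq_iff.mp (show Ad (P ^ n) x = x by rw [h]; rfl)
  simpa using this

/-- A nontrivial automorphism of finite order has an axis. -/
theorem exists_isAxis {φ : AutSl2} (hφ : IsOfFinOrder φ) (hφ1 : φ ≠ 1) :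
    ∃ h, IsAxis h ∧ φ h = h := by
  obtain ⟨P, rfl⟩ := Ad_surjective φ
  set N := tracelessPart P.val with hN
  set t := scalarPart P.val with ht
  have hP : P.val = t • (1 : Matrix (Fin 2) (Fin 2) ℂ) + N.val := eq_scalarPart_add P.val
  -- `N` differs from `P` by a scalar, so it commutes with `P`: the traceless part spans the axis.
  have hfix : Ad P N = N := by
    rw [Ad_apply_eq_iff, hP]
    simp [add_mul, mul_add]
  have hN0 : N ≠ 0 := by
    intro h0
    apply hφ1
    ext1 x
    change _ = x
    rw [Ad_apply_eq_iff, hP, h0]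
    simp
  by_cases hq : form N N = 0
  -- Here `P` is a scalar plus a nilpotent. A power of `P` acting trivially is central, which makes
  -- `N` central, hence zero: the order would be infinite.
  · exfalso
    obtain ⟨n, hn, hn1⟩ := isOfFinOrder_iff_pow_eq_one.mp hφ
    obtain ⟨m, rfl⟩ : ∃ m, n = m + 1 := ⟨n - 1, by omega⟩
    have hpow : P.val ^ (m + 1) = _ := hP ▸ val_pow_of_isotropic (t := t) hq m
    have ht0 : t ≠ 0 := by
      intro h0
      have h2 : P.val ^ (1 + 1) = _ := hP ▸ val_pow_of_isotropic (t := t) hq 1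
      rw [h0] at h2
      have : (P ^ (1 + 1)).val = 0 := by simpa using h2
      exact (P ^ (1 + 1)).ne_zero this
    apply hN0
    apply eq_zero_of_forall_lie
    intro x
    have hx := val_Ad_pow P hn1 x
    rw [hpow, add_mul, mul_add] at hx
    simp only [smul_mul_assoc, mul_smul_comm, one_mul, mul_one, add_right_inj] at hx
    have hc : ((m : ℂ) + 1) * t ^ m ≠ 0 :=
      mul_ne_zero (by exact_mod_cast m.succ_ne_zero) (pow_ne_zero _ ht0)
    have := smul_right_injective _ hc hx
    apply Subtype.ext
    rw [sl_bracket]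
    exact sub_eq_zero.mpr this
  · obtain ⟨s, hs⟩ := IsAlgClosed.exists_eq_mul_self (form N N)
    have hs0 : s ≠ 0 := by rintro rfl; exact hq (by simpa using hs)
    refine ⟨s⁻¹ • N, isAxis_of_form_self_eq_one ?_, by rw [map_smul, hfix]⟩
    have : form (s⁻¹ • N) (s⁻¹ • N) = s⁻¹ * s⁻¹ * form N N := by
      rw [eq_mk N, smul_mk, form_mk, form_mk]; ring
    rw [this, hs]
    field_simp

/-! #### Finite groups of automorphisms of `𝔰𝔩₂` -/

section FiniteGroups

variable {G : Type*} [Group G] {α : G →* AutSl2}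

/-- The stabilizer of an axis embeds in `ℂˣ`, whose finite subgroups are cyclic. -/
theorem isCyclic_comap_stab [Finite G] (hα : Function.Injective α) {h : sl (Fin 2) ℂ} (hh : IsAxis h) :
    IsCyclic ((stab h).comap α) := by
  obtain ⟨χ, hχ⟩ := hh.exists_char
  refine isCyclic_of_injective_ringHom
    ((Units.coeHom ℂ).comp (χ.comp (α.subgroupComap (stab h)))) ?_
  refine Units.val_injective.comp (hχ.comp ?_)
  intro x y hxy
  exact Subtype.ext (hα (congrArg Subtype.val hxy))

theorem index_comap_stab {h : sl (Fin 2) ℂ} (hh : IsAxis h)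
    (hG : ∀ g, α g h = h ∨ α g h = -h) {s : G} (hs : s ∉ (stab h).comap α) :
    ((stab h).comap α).index = 2 := by
  have hs' : α s h = -h := (hG s).resolve_left hs
  have hne : -h ≠ h := by
    intro h0
    have : (2 : ℂ) • h = 0 := by
      rw [two_smul]
      nth_rw 1 [← h0]
      exact neg_add_cancel h
    exact hh.ne_zero ((smul_eq_zero.mp this).resolve_left two_ne_zero)
  rw [Subgroup.index_eq_two_iff]
  refine ⟨s, fun g ↦ ?_⟩
  simp only [Subgroup.mem_comap, mem_stab, map_mul, mul_apply, hs', map_neg]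
  rcases hG g with h1 | h1 <;> simp [h1, hne, xor_def]

variable [Finite G]

/-- An elementary abelian `2`-group of automorphisms of `𝔰𝔩₂` has order at most `4`. -/
theorem card_le_four (hα : Function.Injective α) (h2 : ∀ x : G, x * x = 1) : Nat.card G ≤ 4 := by
  by_cases hG : ∀ x : G, x = 1
  · have : Subsingleton G := ⟨fun x y ↦ (hG x).trans (hG y).symm⟩
    rw [Nat.card_of_subsingleton (1 : G)]
    norm_num
  push Not at hG
  obtain ⟨a, ha⟩ := hG
  obtain ⟨h, hh, hah⟩ := exists_isAxis (φ := α a) (α.isOfFinOrder (isOfFinOrder_of_finite a))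
    (fun h0 ↦ ha (hα (h0.trans (map_one α).symm)))
  have hcomm (x y : G) : x * y = y * x := by
    have hi (z : G) : z⁻¹ = z := inv_eq_of_mul_eq_one_right (h2 z)
    rw [← hi (x * y), _root_.mul_inv_rev, hi, hi]
  -- As `g` commutes with `a`, the vector `α g h` is also fixed by `α a`.
  have hor (g : G) : α g h = h ∨ α g h = -h := by
    refine hh.map_eq_or (α a) (α g) hah (fun h0 ↦ ha (hα (h0.trans (map_one α).symm))) ?_
    rw [← mul_apply, ← map_mul, hcomm, map_mul, mul_apply, hah]
  set C := (stab h).comap α with hC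
  have hcyc : IsCyclic C := isCyclic_comap_stab hα hh
  have hcard : Nat.card C ≤ 2 := by
    rw [← IsCyclic.exponent_eq_card]
    refine Nat.le_of_dvd two_pos (Monoid.exponent_dvd_of_forall_pow_eq_one fun x ↦ ?_)
    rw [pow_two]
    exact Subtype.ext (h2 x)
  have hidx : C.index ≤ 2 := by
    by_cases ht : C = ⊤
    · rw [ht, Subgroup.index_top]; norm_num
    · obtain ⟨s, hs⟩ : ∃ s, s ∉ C := by
        by_contra! h0
        exact ht (Subgroup.eq_top_iff' C |>.mpr h0)
      exact (index_comap_stab hh hor hs).le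
  rw [← C.card_mul_index]
  exact (Nat.mul_le_mul hcard hidx)

/-- A finite group of automorphisms of `𝔰𝔩₂` with an abelian normal subgroup that is not of
exponent `2` is cyclic or dihedral. -/
theorem isCyclicOrDihedral_of_normal (hα : Function.Injective α) (B : Subgroup G) [hB : B.Normal]
    (hcomm : ∀ x ∈ B, ∀ y ∈ B, x * y = y * x) {b : G} (hb : b ∈ B) (hb2 : b * b ≠ 1) :
    IsCyclicOrDihedral G := by
  have hb1 : b ≠ 1 := by rintro rfl; exact hb2 (one_mul 1)
  have hne (x : G) (hx : x ≠ 1) : α x ≠ 1 := fun h0 ↦ hx (hα (h0.trans (map_one α).symm))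
  obtain ⟨h, hh, hbh⟩ := exists_isAxis (φ := α b) (α.isOfFinOrder (isOfFinOrder_of_finite b))
    (hne b hb1)
  have hBh (x : G) (hx : x ∈ B) : α x h = h := by
    refine (hh.map_eq_or (α b) (α x) hbh (hne b hb1) ?_).resolve_right ?_
    · rw [← mul_apply, ← map_mul, hcomm b hb x hx, map_mul, mul_apply, hbh]
    -- Reversing `h` would invert `b`, while `x` commutes with `b`; this contradicts `b² ≠ 1`.
    · intro h0
      have h1 := hh.conj (α b) (α x) hbh h0
      rw [← map_inv, ← map_inv, ← map_mul, ← map_mul] at h1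
      have h2 := hα h1
      rw [hcomm x hx b hb, mul_inv_cancel_right] at h2
      exact hb2 (by nth_rw 1 [h2]; exact inv_mul_cancel b)
  -- The conjugate `g * b * g⁻¹` lies in `B`, so it fixes `h`; it also fixes `α g h`. Hence these
  -- agree up to sign.
  have hor (g : G) : α g h = h ∨ α g h = -h := by
    have hmem := hB.conj_mem b hb g
    refine hh.map_eq_or (α (g * b * g⁻¹)) (α g) (hBh _ hmem) (hne _ ?_) ?_
    · intro h0
      exact hb1 (conj_eq_one_iff.mp h0)
    · rw [← mul_apply, ← map_mul, inv_mul_cancel_right, map_mul, mul_apply, hbh]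
  set C := (stab h).comap α with hC
  have hcyc : IsCyclic C := isCyclic_comap_stab hα hh
  have hbC : b ∈ C := hbh
  by_cases ht : C = ⊤
  · have : IsCyclic G := by
      rw [ht] at hcyc
      exact isCyclic_of_surjective (Subgroup.topEquiv (G := G)) Subgroup.topEquiv.surjective
    exact this.isCyclicOrDihedral
  · obtain ⟨s, hs⟩ : ∃ s, s ∉ C := by
      by_contra! h0
      exact ht (Subgroup.eq_top_iff' C |>.mpr h0)
    have hs' : α s h = -h := (hor s).resolve_left hs
    refine .inr ⟨Nat.card C, ?_, nonempty_mulEquiv_dihedral C hcyc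
      (index_comap_stab hh hor hs) hs ?_ ?_⟩
    · have : Nontrivial C := ⟨⟨b, hbC⟩, 1, fun h0 ↦ hb1 (congrArg Subtype.val h0)⟩
      exact Finite.one_lt_card
    · apply hα
      rw [map_mul, map_one]
      exact hh.mul_self _ hs'
    · intro c hc
      apply hα
      rw [map_mul, map_mul, map_inv, map_inv]
      exact hh.conj _ _ hc hs'

/-- A finite abelian group of automorphisms of `𝔰𝔩₂` is cyclic or a Klein four-group. -/
theorem isCyclicOrDihedral_of_comm (hα : Function.Injective α) (hcomm : ∀ x y : G, x * y = y * x) :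
    IsCyclicOrDihedral G := by
  by_cases h2 : ∀ x : G, x * x = 1
  · exact isCyclicOrDihedral_of_mul_self h2 (card_le_four hα h2)
  · push Not at h2
    obtain ⟨b, hb⟩ := h2
    exact isCyclicOrDihedral_of_normal hα ⊤ (fun x _ y _ ↦ hcomm x y) (Subgroup.mem_top b) hb

end FiniteGroups

/-! #### Cyclic, dihedral and tetrahedral groups of automorphisms of `𝔰𝔩₂` -/

theorem exists_aut_of_det_ne_zero {P : Matrix (Fin 2) (Fin 2) ℂ} (hP : P.det ≠ 0) :
    ∃ φ : AutSl2, ∀ x y : sl (Fin 2) ℂ, P * x.val = y.val * P → φ x = y := by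
  have hu : IsUnit P := (Matrix.isUnit_iff_isUnit_det P).mpr (isUnit_iff_ne_zero.mpr hP)
  exact ⟨Ad hu.unit, fun x y hxy ↦ Ad_apply_eq_iff.mpr hxy⟩

theorem exists_aut_diagonal {c : ℂ} (hc : c ≠ 0) : ∃ φ : AutSl2, φ H = H ∧ φ E = c • E := by
  obtain ⟨φ, hφ⟩ := exists_aut_of_det_ne_zero (P := !![c, 0; 0, 1])
    (by simpa [Matrix.det_fin_two_of] using hc)
  refine ⟨φ, hφ _ _ ?_, hφ _ _ ?_⟩ <;>
  · ext i j
    fin_cases i <;> fin_cases j <;> simp [H, E, mk]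

theorem exists_aut_neg : ∃ φ : AutSl2, φ H = -H := by
  obtain ⟨φ, hφ⟩ := exists_aut_of_det_ne_zero (P := !![0, 1; 1, 0]) (by simp)
  refine ⟨φ, hφ _ _ ?_⟩
  ext i j
  fin_cases i <;> fin_cases j <;> simp [H, mk]

theorem exists_orderOf_eq (N : ℕ) (hN : N ≠ 0) : ∃ φ : AutSl2, φ H = H ∧ orderOf φ = N := by
  have hζ := Complex.isPrimitiveRoot_exp N hN
  set ζ := Complex.exp (2 * Real.pi * Complex.I / N)
  obtain ⟨φ, hφH, hφE⟩ := exists_aut_diagonal (Complex.exp_ne_zero _ : ζ ≠ 0)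
  refine ⟨φ, hφH, ?_⟩
  rw [hζ.eq_orderOf, orderOf_eq_orderOf_iff]
  intro n
  have hH : (φ ^ n) H = H := pow_mem (mem_stab.mpr hφH) n
  have hE : (φ ^ n) E = ζ ^ n • E := by
    induction n with
    | zero => rw [pow_zero, pow_zero, one_smul]; rfl
    | succ n ih =>
      rw [pow_succ, mul_apply, hφE, map_smul, ih (pow_mem (mem_stab.mpr hφH) n), smul_smul,
        pow_succ, mul_comm]
  have hiff := eq_one_iff_of_map_H hH
  rw [hE] at hiff
  refine hiff.trans ?_
  simp [E, smul_mk, mk_inj]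

theorem embedsIn_zmod (N : ℕ) (hN : 1 ≤ N) : EmbedsIn (Multiplicative (ZMod N)) AutSl2 := by
  obtain ⟨φ, -, hφ⟩ := exists_orderOf_eq N (by omega)
  have e := zmodCyclicMulEquiv (G := Subgroup.zpowers φ) inferInstance
  rw [Nat.card_zpowers, hφ] at e
  exact e.embedsIn ((Subgroup.zpowers φ).subtype.embedsIn Subtype.val_injective)

theorem embedsIn_dihedral (N : ℕ) (hN : 1 ≤ N) : EmbedsIn (DihedralGroup N) AutSl2 := by
  obtain ⟨φ, hφH, hφ⟩ := exists_orderOf_eq N (by omega)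
  obtain ⟨s, hs⟩ := exists_aut_neg
  have hle : Subgroup.zpowers φ ≤ stab H := by simpa [mem_stab] using hφH
  have : Finite (Subgroup.zpowers φ) :=
    Nat.finite_of_card_ne_zero (by rw [Nat.card_zpowers, hφ]; omega)
  have h := exists_dihedral_hom_injective (Subgroup.zpowers φ) inferInstance (s := s) ?_
    (isAxis_H.mul_self s hs) (fun c hc ↦ isAxis_H.conj c s (hle hc) hs)
  · rwa [Nat.card_zpowers, hφ] at h
  · intro h0
    have h1 : s H = H := hle h0
    rw [hs, H, neg_mk, mk_inj] at h1
    norm_num at h1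

/-- The Pauli matrices form a basis on which the tetrahedral group acts by signed permutations. -/
theorem aut_ext_pauli {f g : AutSl2} (hH : f H = g H) (hX : f (mk 0 1 1) = g (mk 0 1 1))
    (hY : f (mk 0 (-Complex.I) Complex.I) = g (mk 0 (-Complex.I) Complex.I)) : f = g := by
  have hE : E = (1 / 2 : ℂ) • mk 0 1 1 + (Complex.I / 2) • mk 0 (-Complex.I) Complex.I := by
    have := Complex.I_mul_I
    simp only [E, smul_mk, add_mk, mk_inj]
    refine ⟨by ring, by linear_combination this / 2, by linear_combination -this / 2⟩
  have hF : F = (1 / 2 : ℂ) • mk 0 1 1 - (Complex.I / 2) • mk 0 (-Complex.I) Complex.I := by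
    have := Complex.I_mul_I
    rw [sub_eq_add_neg]
    simp only [F, smul_mk, add_mk, neg_mk, mk_inj]
    refine ⟨by ring, by linear_combination -this / 2, by linear_combination this / 2⟩
  refine aut_ext hH ?_ ?_
  · rw [hE]; simp only [map_add, map_smul, hX, hY]
  · rw [hF]; simp only [map_sub, map_smul, hX, hY]

theorem embedsIn_alternatingGroup : EmbedsIn (alternatingGroup (Fin 4)) AutSl2 := by
  obtain ⟨a, ha⟩ := exists_aut_of_det_ne_zero (P := !![1, 0; 0, -1]) (by simp)
  obtain ⟨b, hb⟩ := exists_aut_of_det_ne_zero (P := !![0, 1; 1, 0]) (by simp)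
  -- `a` and `b` are the half-turns about the Pauli axes `H` and `X`; conjugation by this matrix
  -- permutes the Pauli matrices cyclically, `H → X → Y → H`.
  obtain ⟨g, hg⟩ := exists_aut_of_det_ne_zero (P := !![1, -Complex.I; 1, Complex.I])
    (by rw [Matrix.det_fin_two_of]; simp)
  set X := mk 0 1 1 with hX
  set Y := mk 0 (-Complex.I) Complex.I with hY
  have aH : a H = H := ha _ _ (by ext i j; fin_cases i <;> fin_cases j <;> simp [H, mk])
  have aX : a X = -X := ha _ _ (by ext i j; fin_cases i <;> fin_cases j <;> simp [X, mk])
  have aY : a Y = -Y := ha _ _ (by ext i j; fin_cases i <;> fin_cases j <;> simp [Y, mk])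
  have bH : b H = -H := hb _ _ (by ext i j; fin_cases i <;> fin_cases j <;> simp [H, mk])
  have bX : b X = X := hb _ _ (by ext i j; fin_cases i <;> fin_cases j <;> simp [X, mk])
  have bY : b Y = -Y := hb _ _ (by ext i j; fin_cases i <;> fin_cases j <;> simp [Y, mk])
  have gH : g H = X := hg _ _ (by ext i j; fin_cases i <;> fin_cases j <;> simp [H, X, mk])
  have gX : g X = Y := hg _ _ (by ext i j; fin_cases i <;> fin_cases j <;> simp [Y, X, mk])
  have gY : g Y = H := hg _ _ (by ext i j; fin_cases i <;> fin_cases j <;> simp [H, Y, mk])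
  have hXne : X ≠ -X := by
    rw [hX, neg_mk, Ne, mk_inj]; norm_num
  refine embedsIn_alternatingGroup_four (a := a) (b := b) (g := g) ?_ ?_ ?_ ?_ ?_ ?_ ?_
  · refine aut_ext_pauli ?_ ?_ ?_ <;>
      simp only [← hX, ← hY, mul_apply, aH, aX, aY, map_neg, neg_neg] <;> rfl
  · rintro rfl; exact hXne aX
  · rintro rfl; exact hXne (bX.symm.trans aX)
  · refine aut_ext_pauli ?_ ?_ ?_ <;>
      simp only [← hX, ← hY, mul_apply, aH, aX, aY, bH, bX, bY, map_neg]
  · refine aut_ext_pauli ?_ ?_ ?_ <;>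
      simp only [← hX, ← hY, pow_succ, pow_zero, one_mul, mul_apply, gH, gX, gY] <;> rfl
  · rw [mul_inv_eq_iff_eq_mul]
    refine aut_ext_pauli ?_ ?_ ?_ <;>
      simp only [← hX, ← hY, mul_apply, aH, aX, aY, bH, bX, bY, gH, gX, gY, map_neg]
  · rw [mul_inv_eq_iff_eq_mul]
    refine aut_ext_pauli ?_ ?_ ?_ <;>
      simp only [← hX, ← hY, mul_apply, aH, aX, aY, bH, bX, bY, gH, gX, gY, map_neg, neg_neg]

end Sl2

/-! ### Biholomorphisms of complex tori -/

namespace PeriodPair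

variable (L : PeriodPair)

theorem toTorus_isCoveringMap : IsCoveringMap L.toTorus :=
  (AddSubgroup.isAddQuotientCoveringMap_of_comm L.lattice.toAddSubgroup
    (isDiscrete_iff_discreteTopology.mpr
      (inferInstanceAs (DiscreteTopology L.lattice)))).isCoveringMap

variable {L}

theorem toTorus_eq_iff {z w : ℂ} : L.toTorus z = L.toTorus w ↔ w - z ∈ L.lattice := by
  rw [QuotientAddGroup.eq, neg_add_eq_sub]
  rfl

theorem toTorus_eq_iff' {z w : ℂ} : L.toTorus z = L.toTorus w ↔ z - w ∈ L.lattice := by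
  rw [eq_comm, toTorus_eq_iff]

theorem toTorus_add (z w : ℂ) : L.toTorus (z + w) = L.toTorus z + L.toTorus w := rfl

/-! ### Lifting holomorphic self-maps to the plane -/

/-- A continuous function with values in the lattice is locally constant. -/
theorem eventually_eq_of_mem_lattice {k : ℂ → ℂ} {z : ℂ} (hk : ContinuousAt k z)
    (h : ∀ᶠ v in 𝓝 z, k v ∈ L.lattice) : ∀ᶠ v in 𝓝 z, k v = k z := by
  obtain ⟨U, hU, hU0⟩ : ∃ U ∈ 𝓝 (0 : ℂ), ∀ l ∈ U, l ∈ L.lattice → l = 0 := by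
    have h0 : ({0} : Set L.lattice) ∈ 𝓝 (0 : L.lattice) := by simp
    rw [nhds_subtype] at h0
    obtain ⟨U, hU, h⟩ := h0
    exact ⟨U, hU, fun l hl hl' ↦ congrArg Subtype.val (h (a := ⟨l, hl'⟩) hl)⟩
  have ht : Filter.Tendsto (fun v ↦ k v - k z) (𝓝 z) (𝓝 0) := by
    simpa using hk.tendsto.sub_const (k z)
  filter_upwards [ht hU, h] with v hv hv'
  exact sub_eq_zero.mp (hU0 _ hv (sub_mem hv' h.self_of_nhds))

theorem chartAt_symm_apply (t : L.Torus) (w : ℂ) : (chartAt ℂ t).symm w = L.toTorus w := by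
  change ((L.toTorus_isLocalHomeomorph.localInverseAt
    (L.toTorus_surjective.hasRightInverse.choose t)).trans (.refl ℂ)).symm w = _
  simp

theorem toTorus_chartAt {t s : L.Torus} (hs : s ∈ (chartAt ℂ t).source) :
    L.toTorus (chartAt ℂ t s) = s := by
  rw [← chartAt_symm_apply t, (chartAt ℂ t).left_inv hs]

instance instIsManifoldTorusOne : IsManifold 𝓘(ℂ) 1 L.Torus :=
  .of_le (n := ω) le_top

theorem mdifferentiable_toTorus : MDifferentiable 𝓘(ℂ) 𝓘(ℂ) L.toTorus := by
  intro z
  set t := L.toTorus z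
  set w := chartAt ℂ t t
  have hw : L.toTorus w = t := toTorus_chartAt (mem_chart_source ℂ t)
  have h1 : MDifferentiableAt 𝓘(ℂ) 𝓘(ℂ) (chartAt ℂ t).symm w :=
    mdifferentiableAt_atlas_symm (chart_mem_atlas ℂ t) (mem_chart_target ℂ t)
  have h2 : ((chartAt ℂ t).symm : ℂ → L.Torus) = L.toTorus :=
    funext (chartAt_symm_apply t)
  rw [h2] at h1
  -- The preimage `w` chosen by the chart may differ from `z` by a lattice vector, under which the
  -- projection is invariant.
  have h3 : L.toTorus = L.toTorus ∘ fun v ↦ v + (w - z) := by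
    ext v
    rw [Function.comp_apply, toTorus_eq_iff]
    have : w - z ∈ L.lattice := toTorus_eq_iff.mp hw.symm
    simpa using this
  rw [h3]
  refine MDifferentiableAt.comp z (I' := 𝓘(ℂ)) ?_ ?_
  · simpa using h1
  · exact (differentiableAt_id.add_const _).mdifferentiableAt

/-- A continuous lift to `ℂ` of a holomorphic self-map of a torus is holomorphic. -/
theorem differentiable_lift {f : L.Torus → L.Torus} (hf : MDifferentiable 𝓘(ℂ) 𝓘(ℂ) f)
    {F : ℂ → ℂ} (hF : Continuous F) (h : ∀ z, L.toTorus (F z) = f (L.toTorus z)) :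
    Differentiable ℂ F := by
  intro z
  set t := f (L.toTorus z)
  set e := chartAt ℂ t
  have hm : MDifferentiableAt 𝓘(ℂ) 𝓘(ℂ) (fun v ↦ e (f (L.toTorus v))) z := by
    have h1 : MDifferentiableAt 𝓘(ℂ) 𝓘(ℂ) (f ∘ L.toTorus) z :=
      (hf _).comp z (mdifferentiable_toTorus z)
    exact MDifferentiableAt.comp z (I' := 𝓘(ℂ))
      (mdifferentiableAt_atlas (chart_mem_atlas ℂ t) (mem_chart_source ℂ t)) h1
  have hd : DifferentiableAt ℂ (fun v ↦ e (f (L.toTorus v))) z :=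
    mdifferentiableAt_iff_differentiableAt.mp hm
  have hcont : Continuous fun v ↦ f (L.toTorus v) :=
    hf.continuous.comp mdifferentiable_toTorus.continuous
  -- `F` and the chart expression lift the same map, so they differ by a lattice vector, which is
  -- locally constant.
  have hev : ∀ᶠ v in 𝓝 z, e (f (L.toTorus v)) - F v ∈ L.lattice := by
    have : ∀ᶠ v in 𝓝 z, f (L.toTorus v) ∈ e.source :=
      hcont.continuousAt.eventually_mem (e.open_source.mem_nhds (mem_chart_source ℂ t))
    filter_upwards [this] with v hv
    rw [← toTorus_eq_iff, h, toTorus_chartAt hv]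
  have hk := eventually_eq_of_mem_lattice (hd.continuousAt.sub hF.continuousAt) hev
  refine (hd.sub_const (e (f (L.toTorus z)) - F z)).congr_of_eventuallyEq ?_
  filter_upwards [hk] with v hv
  simp only [Pi.sub_apply] at hv
  linear_combination -hv

/-- Maps of tori induced by entire functions are holomorphic. -/
theorem mdifferentiable_of_lift {f : L.Torus → L.Torus} {F : ℂ → ℂ} (hF : Differentiable ℂ F)
    (h : ∀ z, f (L.toTorus z) = L.toTorus (F z)) : MDifferentiable 𝓘(ℂ) 𝓘(ℂ) f := by
  intro t
  set e := chartAt ℂ t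
  have hm : MDifferentiableAt 𝓘(ℂ) 𝓘(ℂ) (L.toTorus ∘ F ∘ e) t := by
    refine (mdifferentiable_toTorus _).comp t (I' := 𝓘(ℂ)) ?_
    exact MDifferentiableAt.comp t (I' := 𝓘(ℂ)) (hF _).mdifferentiableAt
      (mdifferentiableAt_atlas (chart_mem_atlas ℂ t) (mem_chart_source ℂ t))
  refine hm.congr_of_eventuallyEq ?_
  filter_upwards [e.open_source.mem_nhds (mem_chart_source ℂ t)] with s hs
  simp only [Function.comp_apply]
  rw [← h, toTorus_chartAt hs]

/-- A holomorphic self-map of a torus is affine. -/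
theorem exists_affine {f : L.Torus → L.Torus} (hf : MDifferentiable 𝓘(ℂ) 𝓘(ℂ) f) :
    ∃ ζ b : ℂ, ∀ z, f (L.toTorus z) = L.toTorus (ζ * z + b) := by
  obtain ⟨b, hb⟩ := L.toTorus_surjective (f (L.toTorus 0))
  obtain ⟨F, ⟨-, hF⟩, -⟩ := L.toTorus_isCoveringMap.existsUnique_continuousMap_lifts
    (⟨f ∘ L.toTorus, hf.continuous.comp mdifferentiable_toTorus.continuous⟩ : C(ℂ, L.Torus)) 0 b hb
  have hF' (z : ℂ) : L.toTorus (F z) = f (L.toTorus z) := congrFun hF z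
  have hd : Differentiable ℂ F := differentiable_lift hf F.continuous hF'
  -- `F (v + w) - F v` takes values in the lattice, so it is locally constant and its derivative
  -- vanishes.
  have hper (z w : ℂ) (hw : w ∈ L.lattice) : deriv F (z + w) = deriv F z := by
    have hd1 : DifferentiableAt ℂ (fun v ↦ F (v + w)) z :=
      (hd _).comp z (differentiableAt_id.add_const w)
    have hk := eventually_eq_of_mem_lattice (L := L) (hd1.sub (hd z)).continuousAt (by
      refine Filter.Eventually.of_forall fun v ↦ ?_
      simp only [Pi.sub_apply]
      rw [← toTorus_eq_iff, hF', hF']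
      congr 1
      rw [toTorus_eq_iff]
      simpa using hw)
    have h0 := Filter.EventuallyEq.deriv_eq (f := fun _ ↦ _) hk
    rw [deriv_const, deriv_sub hd1 (hd z), deriv_comp_add_const] at h0
    exact sub_eq_zero.mp h0
  have hcont : Continuous (deriv F) := hd.deriv.continuous
  -- A periodic continuous function is bounded, so Liouville's theorem applies to the derivative.
  have hconst (z : ℂ) : deriv F z = deriv F 0 := hd.deriv.apply_eq_apply_of_bounded
    (IsZLattice.isCompact_range_of_periodic L.lattice _ hcont hper).isBounded z 0
  refine ⟨deriv F 0, F 0, fun z ↦ ?_⟩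
  rw [← hF']
  congr 1
  have hd2 : Differentiable ℂ fun v ↦ F v - deriv F 0 * v :=
    hd.sub (differentiable_id.const_mul _)
  have := is_const_of_deriv_eq_zero hd2 (fun v ↦ by
    rw [deriv_fun_sub (hd v) (differentiableAt_fun_id.const_mul _), hconst]
    simp) z 0
  simp only [mul_zero, sub_zero] at this
  linear_combination this

/-! ### The linear part of a torus automorphism -/

theorem linear_unique {ζ b ζ' b' : ℂ}
    (h : ∀ z, L.toTorus (ζ * z + b) = L.toTorus (ζ' * z + b')) : ζ = ζ' := by
  have hd : DifferentiableAt ℂ (fun z ↦ (ζ' - ζ) * z + (b' - b)) 0 := by fun_prop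
  have hk := eventually_eq_of_mem_lattice (L := L) hd.continuousAt
    (Filter.Eventually.of_forall fun z ↦ by
      have := toTorus_eq_iff.mp (h z)
      convert this using 1
      ring)
  have h0 := Filter.EventuallyEq.deriv_eq (f := fun _ ↦ _) hk
  rw [deriv_const] at h0
  simp at h0
  exact (sub_eq_zero.mp h0).symm

theorem biholomorphisms_ext {f g : Biholomorphisms L.Torus}
    (h : ∀ z, f.1 (L.toTorus z) = g.1 (L.toTorus z)) : f = g := by
  apply Subtype.ext
  ext t
  obtain ⟨z, rfl⟩ := L.toTorus_surjective t
  exact h z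

theorem mul_apply (f g : Biholomorphisms L.Torus) (t : L.Torus) : (f * g).1 t = f.1 (g.1 t) := rfl

variable (L) in
/-- The linear part of an automorphism `z ↦ ζ z + b` of a complex torus. -/
def linearPart : Biholomorphisms L.Torus →* ℂˣ :=
  MonoidHom.toHomUnits
    { toFun f := (exists_affine f.2.1).choose
      map_one' := by
        obtain ⟨b, hb⟩ := (exists_affine (1 : Biholomorphisms L.Torus).2.1).choose_spec
        refine linear_unique (L := L) (b := b) (b' := 0) fun z ↦ ?_
        rw [← hb, one_mul, add_zero]
        rfl
      map_mul' f g := by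
        obtain ⟨b, hb⟩ := (exists_affine (f * g).2.1).choose_spec
        obtain ⟨c, hc⟩ := (exists_affine f.2.1).choose_spec
        obtain ⟨d, hd⟩ := (exists_affine g.2.1).choose_spec
        refine linear_unique (L := L) (b := b) (b' := (exists_affine f.2.1).choose * d + c)
          fun z ↦ ?_
        rw [← hb]
        refine (congrArg f.1 (hd z)).trans ((hc _).trans ?_)
        congr 1
        ring }

theorem exists_eq_linearPart_mul_add (f : Biholomorphisms L.Torus) :
    ∃ b : ℂ, ∀ z, f.1 (L.toTorus z) = L.toTorus (L.linearPart f * z + b) :=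
  (exists_affine f.2.1).choose_spec

theorem linearPart_eq {f : Biholomorphisms L.Torus} {ζ b : ℂ}
    (h : ∀ z, f.1 (L.toTorus z) = L.toTorus (ζ * z + b)) : (L.linearPart f : ℂ) = ζ := by
  obtain ⟨c, hc⟩ := exists_eq_linearPart_mul_add f
  exact linear_unique fun z ↦ (hc z).symm.trans (h z)

theorem linearPart_eq_one_iff {f : Biholomorphisms L.Torus} :
    L.linearPart f = 1 ↔ f ∈ L.translations := by
  constructor
  · intro h
    obtain ⟨b, hb⟩ := exists_eq_linearPart_mul_add f
    refine ⟨L.toTorus b, fun t ↦ ?_⟩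
    obtain ⟨z, rfl⟩ := L.toTorus_surjective t
    refine (hb z).trans ?_
    rw [h, Units.val_one, one_mul, toTorus_add]
  · rintro ⟨a, ha⟩
    obtain ⟨b, rfl⟩ := L.toTorus_surjective a
    apply Units.ext
    refine linearPart_eq (b := b) fun z ↦ ?_
    rw [ha, Units.val_one, one_mul, toTorus_add]

theorem translations_comm {f g : Biholomorphisms L.Torus} (hf : f ∈ L.translations)
    (hg : g ∈ L.translations) : f * g = g * f := by
  obtain ⟨a, ha⟩ := hf
  obtain ⟨b, hb⟩ := hg
  refine biholomorphisms_ext fun z ↦ ?_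
  rw [mul_apply, mul_apply, ha, hb, hb, ha, add_right_comm]

theorem mul_mem_lattice (f : Biholomorphisms L.Torus) {l : ℂ} (hl : l ∈ L.lattice) :
    L.linearPart f * l ∈ L.lattice := by
  obtain ⟨b, hb⟩ := exists_eq_linearPart_mul_add f
  have h : L.toTorus 0 = L.toTorus l := toTorus_eq_iff.mpr (by simpa using hl)
  have h1 := hb 0
  rw [h, hb l, toTorus_eq_iff'] at h1
  convert h1 using 1
  ring

/-- Multiplication by `ζ` on the torus, for `ζ` preserving the lattice. -/
def torusMul {ζ : ℂ} (h : ∀ l ∈ L.lattice, ζ * l ∈ L.lattice) : L.Torus →+ L.Torus :=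
  QuotientAddGroup.map _ _ (AddMonoidHom.mulLeft ζ) h

/-- Affine automorphisms of the torus. -/
theorem exists_biholomorphism {ζ η : ℂ} (h : ζ * η = 1) (hζ : ∀ l ∈ L.lattice, ζ * l ∈ L.lattice)
    (hη : ∀ l ∈ L.lattice, η * l ∈ L.lattice) (b : ℂ) :
    ∃ f : Biholomorphisms L.Torus, ∀ z, f.1 (L.toTorus z) = L.toTorus (ζ * z + b) := by
  have h1 (z : ℂ) : torusMul hζ (L.toTorus z) + L.toTorus b = L.toTorus (ζ * z + b) := rfl
  have h2 (z : ℂ) : torusMul hη (L.toTorus z - L.toTorus b) = L.toTorus (η * (z - b)) := rfl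
  have hd1 := mdifferentiable_of_lift (L := L)
    (f := fun t ↦ torusMul hζ t + L.toTorus b) (F := fun z ↦ ζ * z + b) (by fun_prop) h1
  have hd2 := mdifferentiable_of_lift (L := L)
    (f := fun t ↦ torusMul hη (t - L.toTorus b)) (F := fun z ↦ η * (z - b)) (by fun_prop) h2
  refine ⟨⟨⟨⟨fun t ↦ torusMul hζ t + L.toTorus b, fun t ↦ torusMul hη (t - L.toTorus b), ?_, ?_⟩,
    hd1.continuous, hd2.continuous⟩, hd1, hd2⟩, h1⟩
  · intro t
    obtain ⟨z, rfl⟩ := L.toTorus_surjective t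
    simp only [h1, h2]
    congr 1
    linear_combination z * h
  · intro t
    obtain ⟨z, rfl⟩ := L.toTorus_surjective t
    simp only [h1, h2]
    congr 1
    linear_combination (z - b) * h

variable (L) in
theorem exists_translation (b : ℂ) :
    ∃ f : Biholomorphisms L.Torus, ∀ z, f.1 (L.toTorus z) = L.toTorus (z + b) := by
  simpa using exists_biholomorphism (L := L) (mul_one 1) (by simp) (by simp) b

variable (L) in
theorem exists_neg :
    ∃ f : Biholomorphisms L.Torus, ∀ z, f.1 (L.toTorus z) = L.toTorus (-z) := by
  simpa using exists_biholomorphism (L := L) (ζ := -1) (η := -1) (by norm_num) (by simp) (by simp) 0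

theorem mul_self_of_linearPart_eq_neg_one {f : Biholomorphisms L.Torus}
    (h : (L.linearPart f : ℂ) = -1) : f * f = 1 := by
  obtain ⟨b, hb⟩ := exists_eq_linearPart_mul_add f
  refine biholomorphisms_ext fun z ↦ ?_
  rw [mul_apply, hb, hb, h]
  change _ = L.toTorus z
  congr 1
  ring

/-- The translation part of the cube is `(1 + ζ + ζ²)b = 0`, whatever `b` is. -/
theorem pow_three_of_linearPart {f : Biholomorphisms L.Torus}
    (h : (L.linearPart f : ℂ) ^ 2 + L.linearPart f + 1 = 0) : f ^ 3 = 1 := by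
  obtain ⟨b, hb⟩ := exists_eq_linearPart_mul_add f
  refine biholomorphisms_ext fun z ↦ ?_
  rw [pow_succ, pow_two, mul_apply, mul_apply, hb, hb, hb]
  change _ = L.toTorus z
  congr 1
  linear_combination (z * (L.linearPart f - 1) + b) * h

/-- An automorphism with linear part of order `3` commutes with no translation of order `2`. -/
theorem eq_one_of_commute {f t : Biholomorphisms L.Torus}
    (h : (L.linearPart f : ℂ) ^ 2 + L.linearPart f + 1 = 0) (ht : t ∈ L.translations)
    (ht2 : t * t = 1) (hft : f * t = t * f) : t = 1 := by
  have hlin (l : ℂ) (hl : l ∈ L.lattice) := mul_mem_lattice f hl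
  set ζ : ℂ := (L.linearPart f : ℂ)
  obtain ⟨b, hb⟩ := exists_eq_linearPart_mul_add f
  obtain ⟨a', ha⟩ := ht
  obtain ⟨a, rfl⟩ := L.toTorus_surjective a'
  have h1 : L.toTorus (a + a) = L.toTorus 0 := by
    have := congrArg (fun g : Biholomorphisms L.Torus ↦ g.1 (L.toTorus 0)) ht2
    simp only [mul_apply, ha] at this
    rw [← toTorus_add, ← toTorus_add, zero_add] at this
    exact this
  have h2 : L.toTorus (ζ * a + b) = L.toTorus (b + a) := by
    have := congrArg (fun g : Biholomorphisms L.Torus ↦ g.1 (L.toTorus 0)) hft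
    simp only [mul_apply, ha, hb] at this
    rw [← toTorus_add, hb, ← toTorus_add, zero_add, mul_zero, zero_add] at this
    exact this
  rw [toTorus_eq_iff'] at h1 h2
  have h3 : a ∈ L.lattice := by
    -- Both `2a` and `(ζ - 1)a` are lattice vectors. Since `(ζ + 2)(ζ - 1) = -3`, so is `3a`, hence
    -- `a`.
    have h4 := sub_mem (neg_mem (add_mem (add_mem h2 h2) (hlin _ h2))) h1
    convert h4 using 1
    linear_combination a * h
  refine biholomorphisms_ext fun z ↦ ?_
  rw [ha, ← toTorus_add]
  change _ = L.toTorus z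
  rw [toTorus_eq_iff']
  simpa using h3

/-- The crystallographic restriction. -/
theorem lattice_multiplier_cases {ζ : ℂ} (hζ : ∀ l ∈ L.lattice, ζ * l ∈ L.lattice)
    (h1 : ‖ζ‖ = 1) :
    ζ = 1 ∨ ζ = -1 ∨ ζ ^ 2 + 1 = 0 ∨ ζ ^ 2 + ζ + 1 = 0 ∨ ζ ^ 2 - ζ + 1 = 0 := by
  obtain ⟨a, b, hab⟩ := mem_lattice.mp (hζ _ L.ω₁_mem_lattice)
  obtain ⟨c, d, hcd⟩ := mem_lattice.mp (hζ _ L.ω₂_mem_lattice)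
  have hω : L.ω₁ ≠ 0 := by
    have := L.indep.ne_zero 0
    simpa using this
  -- Multiplication by `ζ` is an integer matrix in the basis of periods; `t` and `D` are its trace
  -- and determinant.
  obtain ⟨t, D, htD⟩ : ∃ t D : ℤ, ζ ^ 2 = t * ζ - D := by
    refine ⟨a + d, a * d - b * c, ?_⟩
    apply mul_left_cancel₀ hω
    push_cast
    linear_combination (d - ζ) * hab - b * hcd
  have hn : ζ.re * ζ.re + ζ.im * ζ.im = 1 := by
    rw [← Complex.normSq_apply, Complex.normSq_eq_norm_sq, h1, one_pow]
  by_cases hi : ζ.im = 0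
  · rw [hi, mul_zero, add_zero] at hn
    rcases mul_self_eq_one_iff.mp hn with h | h
    · exact .inl (Complex.ext h (by simpa using hi))
    · exact .inr (.inl (Complex.ext (by simpa using h) (by simpa using hi)))
  · have hre := congrArg Complex.re htD
    have him := congrArg Complex.im htD
    simp only [pow_two, Complex.mul_re, Complex.mul_im, Complex.sub_re, Complex.sub_im,
      Complex.intCast_re, Complex.intCast_im, zero_mul, sub_zero, add_zero] at hre him
    -- For nonreal `ζ`, the trace is `2 Re ζ` and the determinant `|ζ|² = 1`, so the integer `t`
    -- satisfies `|t| < 2`.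
    have ht : (t : ℝ) = 2 * ζ.re := by
      apply mul_right_cancel₀ hi
      linear_combination -him
    have hD : (D : ℝ) = 1 := by
      rw [ht] at hre
      linear_combination hn + hre
    have hD' : D = 1 := by exact_mod_cast hD
    have hlt : (t : ℝ) * t < 4 := by
      rw [ht]
      have : 0 < ζ.im * ζ.im := mul_self_pos.mpr hi
      nlinarith
    have hlt' : t * t < 4 := by exact_mod_cast hlt
    have hb1 : t < 2 := by nlinarith
    have hb2 : -2 < t := by nlinarith
    subst hD'
    right; right
    obtain rfl | rfl | rfl : t = -1 ∨ t = 0 ∨ t = 1 := by omega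
    · right; left; rw [htD]; push_cast; ring
    · left; rw [htD]; push_cast; ring
    · right; right; rw [htD]; push_cast; ring

/-- A lattice with multiplication by a primitive cube root of unity has `g₂ = 0`. -/
theorem g₂_eq_zero {ρ : ℂ} (h : ρ ^ 2 + ρ + 1 = 0) (hρ : ∀ l ∈ L.lattice, ρ * l ∈ L.lattice) :
    L.g₂ = 0 := by
  have h3 : ρ * (ρ * ρ) = 1 := by linear_combination (ρ - 1) * h
  let e : L.lattice ≃ L.lattice :=
    { toFun l := ⟨ρ * l, hρ _ l.2⟩
      invFun l := ⟨ρ * (ρ * l), hρ _ (hρ _ l.2)⟩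
      left_inv l := Subtype.ext (by
        change ρ * (ρ * (ρ * l)) = (l : ℂ)
        linear_combination (l : ℂ) * h3)
      right_inv l := Subtype.ext (by
        change ρ * (ρ * (ρ * l)) = (l : ℂ)
        linear_combination (l : ℂ) * h3) }
  have h0 : ρ ≠ 0 := left_ne_zero_of_mul_eq_one h3
  -- Multiplication by `ρ` permutes the lattice, so reindexing the sum gives this factor, which is
  -- not `1` because `ρ ^ 4 = ρ`.
  have hG : L.G 4 = (ρ ^ 4)⁻¹ * L.G 4 := by
    conv_lhs => rw [G, ← e.tsum_eq]
    rw [G, ← tsum_mul_left]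
    congr with l
    change ((ρ * l) ^ 4)⁻¹ = _
    rw [mul_pow, mul_inv]
  have h4 : ρ ^ 4 = ρ := by linear_combination ρ * h3
  rw [h4, eq_inv_mul_iff_mul_eq₀ h0] at hG
  have h5 : (ρ - 1) * L.G 4 = 0 := by linear_combination hG
  rcases mul_eq_zero.mp h5 with h6 | h6
  · have : ρ = 1 := sub_eq_zero.mp h6
    rw [this] at h
    norm_num at h
  · rw [g₂, h6, mul_zero]

/-! ### Lattices with `g₂ = 0` -/

/-- The regularised form at the origin of the differential equation of `℘`, for `u = ℘ - z⁻²` and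
`g₂ = 0`. -/
def RegularizedEquation (c : ℂ) (u : ℂ → ℂ) (z : ℂ) : Prop :=
  -4 * z * deriv u z + z ^ 4 * deriv u z ^ 2 =
    12 * u z + 12 * z ^ 2 * u z ^ 2 + 4 * z ^ 4 * u z ^ 3 - c * z ^ 4

/-- The regularised equation has only one analytic solution at the origin. -/
theorem eventuallyEq_of_regularizedEquation {c : ℂ} {u v : ℂ → ℂ} (hu : AnalyticAt ℂ u 0)
    (hv : AnalyticAt ℂ v 0) (hue : ∀ᶠ z in 𝓝[≠] 0, RegularizedEquation c u z)
    (hve : ∀ᶠ z in 𝓝[≠] 0, RegularizedEquation c v z) : u =ᶠ[𝓝 0] v := by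
  by_contra hne
  have hD : AnalyticAt ℂ (u - v) 0 := hu.sub hv
  have hne' : ¬ ∀ᶠ z in 𝓝 0, (u - v) z = 0 := by
    intro h
    apply hne
    filter_upwards [h] with z hz
    exact sub_eq_zero.mp hz
  -- Let `n` be the vanishing order of `u - v`. Subtracting the equations and dividing by `z ^ n`
  -- gives `A = B`; at the origin this reads `-4n E(0) = 12 E(0)`, impossible as `n ≥ 0`.
  obtain ⟨n, E, hE, hE0, hDE⟩ := hD.exists_eventuallyEq_pow_smul_nonzero_iff.mpr hne'
  simp only [sub_zero, smul_eq_mul] at hDE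
  set A : ℂ → ℂ := fun z ↦ (n * E z + z * deriv E z) *
    (-4 + z ^ 3 * (deriv u z + deriv v z)) with hA
  set B : ℂ → ℂ := fun z ↦ E z * (12 + 12 * z ^ 2 * (u z + v z)
    + 4 * z ^ 4 * (u z ^ 2 + u z * v z + v z ^ 2)) with hB
  have hu' := hu.deriv.continuousAt
  have hv' := hv.deriv.continuousAt
  have hE' := hE.deriv.continuousAt
  have hcu := hu.continuousAt
  have hcv := hv.continuousAt
  have hcE := hE.continuousAt
  have hAc : ContinuousAt A 0 := by fun_prop
  have hBc : ContinuousAt B 0 := by fun_prop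
  have hAB : A =ᶠ[𝓝[≠] 0] B := by
    have hDe : ∀ᶠ z in 𝓝 (0 : ℂ), deriv (u - v) z = deriv (fun z ↦ z ^ n * E z) z :=
      Filter.EventuallyEq.deriv hDE
    filter_upwards [hue, hve, self_mem_nhdsWithin, hDe.filter_mono nhdsWithin_le_nhds,
      hDE.filter_mono nhdsWithin_le_nhds, hu.eventually_analyticAt.filter_mono nhdsWithin_le_nhds,
      hv.eventually_analyticAt.filter_mono nhdsWithin_le_nhds,
      hE.eventually_analyticAt.filter_mono nhdsWithin_le_nhds]
      with z h1 h2 hz h3 h4 h5 h6 h7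
    have hz : z ≠ 0 := hz
    rw [deriv_sub h5.differentiableAt h6.differentiableAt,
      deriv_fun_mul (by fun_prop) h7.differentiableAt] at h3
    simp only [deriv_pow_field] at h3
    have h3' : z * (deriv u z - deriv v z) = z ^ n * (n * E z + z * deriv E z) := by
      rw [h3]
      rcases n with _ | n
      · simp
      · rw [Nat.add_sub_cancel, pow_succ]; push_cast; ring
    simp only [Pi.sub_apply] at h4
    unfold RegularizedEquation at h1 h2
    apply mul_left_cancel₀ (pow_ne_zero n hz)
    simp only [hA, hB]
    linear_combination h1 - h2 - (-4 + z ^ 3 * (deriv u z + deriv v z)) * h3'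
      + (12 + 12 * z ^ 2 * (u z + v z) + 4 * z ^ 4 * (u z ^ 2 + u z * v z + v z ^ 2)) * h4
  have h0 : A 0 = B 0 := tendsto_nhds_unique
    ((hAc.tendsto.mono_left nhdsWithin_le_nhds).congr' hAB)
    (hBc.tendsto.mono_left nhdsWithin_le_nhds)
  simp only [hA, hB] at h0
  have h1 : ((4 * n + 12 : ℕ) : ℂ) * E 0 = 0 := by
    push_cast
    linear_combination -h0
  rcases mul_eq_zero.mp h1 with h | h
  · rw [Nat.cast_eq_zero] at h
    omega
  · exact hE0 h

theorem weierstrassP_eq {z : ℂ} : ℘[L] z = ℘[L - (0 : ℂ)] z + 1 / z ^ 2 := by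
  have := L.weierstrassPExcept_add 0 z
  simp at this
  rw [← this]; simp

theorem eventually_notMem_lattice : ∀ᶠ z in 𝓝[≠] (0 : ℂ), z ∉ L.lattice := by
  filter_upwards [self_mem_nhdsWithin, mem_nhdsWithin_of_mem_nhds
    (L.compl_lattice_sdiff_singleton_mem_nhds 0)] with z hz hz' h
  exact hz' ⟨h, hz⟩

/-- Inserting `℘ = u + z⁻²` into the differential equation and multiplying by `z ^ 4` cancels the
polar terms `4 / z²`. -/
theorem regularizedEquation_weierstrassPExcept (hg : L.g₂ = 0) :
    ∀ᶠ z in 𝓝[≠] 0, RegularizedEquation L.g₃ ℘[L - (0 : ℂ)] z := by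
  have han : AnalyticAt ℂ ℘[L - (0 : ℂ)] 0 := L.analyticAt_weierstrassPExcept 0
  filter_upwards [eventually_notMem_lattice (L := L), self_mem_nhdsWithin,
    han.eventually_analyticAt.filter_mono nhdsWithin_le_nhds] with z hz hz0 ha
  have hz0 : z ≠ 0 := hz0
  have h := L.derivWeierstrassP_sq z hz
  have hd : ℘'[L] z = deriv ℘[L - (0 : ℂ)] z - 2 / z ^ 3 := by
    rw [← deriv_weierstrassP]
    have : ℘[L] = fun z ↦ ℘[L - (0 : ℂ)] z + 1 / z ^ 2 := funext fun _ ↦ weierstrassP_eq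
    rw [this, deriv_fun_add ha.differentiableAt
      (by fun_prop (disch := simpa))]
    have h2 : deriv (fun z : ℂ ↦ 1 / z ^ 2) z = -2 / z ^ 3 := by
      have h3 := ((hasDerivAt_pow 2 z).fun_inv (pow_ne_zero 2 hz0)).deriv
      simp only [one_div]
      rw [h3]
      push_cast
      field_simp
    rw [h2]; ring
  rw [hd, weierstrassP_eq, hg] at h
  unfold RegularizedEquation
  set u := ℘[L - (0 : ℂ)] z
  set d := deriv ℘[L - (0 : ℂ)] z
  have h4 : z ^ 4 * (d - 2 / z ^ 3) ^ 2 = z ^ 4 * d ^ 2 - 4 * z * d + 4 / z ^ 2 := by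
    field_simp
    ring
  have h5 : z ^ 4 * (4 * (u + 1 / z ^ 2) ^ 3) =
      4 * z ^ 4 * u ^ 3 + 12 * z ^ 2 * u ^ 2 + 12 * u + 4 / z ^ 2 := by
    field_simp
    ring
  linear_combination z ^ 4 * h - h4 + h5

/-- If `g₂ = 0`, then the lattice is stable under multiplication by primitive cube roots of
unity. -/
theorem mul_mem_lattice_of_g₂_eq_zero (hg : L.g₂ = 0) {ρ : ℂ} (h : ρ ^ 2 + ρ + 1 = 0) :
    ∀ l ∈ L.lattice, ρ * l ∈ L.lattice := by
  have h3 : ρ ^ 3 = 1 := by linear_combination (ρ - 1) * h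
  have hρ0 : ρ ≠ 0 := by rintro rfl; norm_num at h
  set u := ℘[L - (0 : ℂ)] with hu
  have han : AnalyticAt ℂ u 0 := L.analyticAt_weierstrassPExcept 0
  have hscale : Filter.Tendsto (fun z ↦ ρ * z) (𝓝[≠] 0) (𝓝[≠] 0) := by
    refine tendsto_nhdsWithin_of_tendsto_nhds_of_eventually_within _ ?_ ?_
    · have : ContinuousAt (fun z : ℂ ↦ ρ * z) 0 := by fun_prop
      simpa using this.tendsto.mono_left nhdsWithin_le_nhds
    · filter_upwards [self_mem_nhdsWithin] with z hz
      exact mul_ne_zero hρ0 hz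
  -- With `g₂ = 0` and `ρ³ = 1` the rotated function satisfies the same equation, so it agrees with
  -- `u` near the origin.
  set v : ℂ → ℂ := fun z ↦ ρ ^ 2 * u (ρ * z) with hv
  have hanv : AnalyticAt ℂ v 0 := by
    have : AnalyticAt ℂ u (ρ * 0) := by rwa [mul_zero]
    have h1 : AnalyticAt ℂ (fun z ↦ u (ρ * z)) 0 :=
      AnalyticAt.fun_comp this (by fun_prop)
    fun_prop
  have hue := regularizedEquation_weierstrassPExcept hg
  have hve : ∀ᶠ z in 𝓝[≠] 0, RegularizedEquation L.g₃ v z := by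
    filter_upwards [hscale.eventually hue] with z hz
    have hd : deriv v z = deriv u (ρ * z) := by
      rw [hv, deriv_const_mul_field, deriv_comp_mul_left, smul_eq_mul]
      linear_combination deriv u (ρ * z) * h3
    unfold RegularizedEquation at hz ⊢
    rw [hd]
    simp only [hv]
    set w := u (ρ * z)
    set d := deriv u (ρ * z)
    have h4 : ρ ^ 4 = ρ := by linear_combination ρ * h3
    have h6 : ρ ^ 6 = 1 := by linear_combination (ρ ^ 3 + 1) * h3
    linear_combination ρ ^ 2 * hz + (4 * z * d) * h3 - z ^ 4 * d ^ 2 * h6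
      + L.g₃ * z ^ 4 * h6 * (-1)
  have huv := eventuallyEq_of_regularizedEquation han hanv hue hve
  set S : Set ℂ := (L.lattice : Set ℂ) ∪ (fun z ↦ ρ * z) ⁻¹' L.lattice with hS
  have hScl : IsClosed S := L.isClosed_lattice.union (L.isClosed_lattice.preimage (by fun_prop))
  have hcount : (L.lattice : Set ℂ).Countable :=
    Set.countable_coe_iff.mp L.latticeEquivProd.injective.countable
  have hScount : S.Countable :=
    hcount.union (hcount.preimage (mul_right_injective₀ hρ0))
  -- The poles of either side lie in the countable set `S`, whose complement in the plane is
  -- connected; the identity theorem then applies.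
  have hpre : IsPreconnected Sᶜ :=
    (hScount.isPathConnected_compl_of_one_lt_rank (by
      rw [Complex.rank_real_complex]; norm_num)).isConnected.isPreconnected
  have hf : AnalyticOnNhd ℂ ℘[L] Sᶜ := fun z hz ↦
    L.analyticOnNhd_weierstrassP z (fun h ↦ hz (.inl h))
  have hganalytic (z : ℂ) (hz : ρ * z ∉ L.lattice) :
      AnalyticAt ℂ (fun z ↦ ρ ^ 2 * ℘[L] (ρ * z)) z := by
    have h1 : AnalyticAt ℂ (fun z ↦ ℘[L] (ρ * z)) z :=
      AnalyticAt.fun_comp (L.analyticOnNhd_weierstrassP _ hz) (by fun_prop)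
    fun_prop
  have hgn : AnalyticOnNhd ℂ (fun z ↦ ρ ^ 2 * ℘[L] (ρ * z)) Sᶜ := fun z hz ↦
    hganalytic z (fun h ↦ hz (.inr h))
  have hnear : ∀ᶠ z in 𝓝[≠] 0, ℘[L] z = ρ ^ 2 * ℘[L] (ρ * z) := by
    filter_upwards [huv.filter_mono nhdsWithin_le_nhds, self_mem_nhdsWithin] with z hz hz0
    have hz0 : z ≠ 0 := hz0
    rw [weierstrassP_eq, weierstrassP_eq, ← hu, hz]
    simp only [hv]
    field_simp
  have hnotS : ∀ᶠ z in 𝓝[≠] 0, z ∉ S := by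
    filter_upwards [eventually_notMem_lattice (L := L),
      hscale.eventually (eventually_notMem_lattice (L := L))] with z h1 h2 h3
    exact h3.elim h1 h2
  obtain ⟨z₀, hz₀, hz₀e⟩ : ∃ z₀ ∈ Sᶜ, ℘[L] =ᶠ[𝓝 z₀] fun z ↦ ρ ^ 2 * ℘[L] (ρ * z) := by
    have h1 := (eventually_eventually_nhdsWithin.mpr hnear).and (hnotS.and self_mem_nhdsWithin)
    obtain ⟨z₀, h2, h3, h4⟩ := h1.exists
    refine ⟨z₀, h3, ?_⟩
    have h5 : 𝓝[{0}ᶜ] z₀ = 𝓝 z₀ := isOpen_compl_singleton.nhdsWithin_eq h4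
    rwa [h5] at h2
  have heq := hf.eqOn_of_preconnected_of_eventuallyEq hgn hpre hz₀ hz₀e
  intro l hl
  by_contra hl'
  -- At `l` the left side has a pole, while the right side would be analytic if `ρ * l` were not in
  -- the lattice.
  have hmer := L.order_weierstrassP l hl
  have hev : ℘[L] =ᶠ[𝓝[≠] l] fun z ↦ ρ ^ 2 * ℘[L] (ρ * z) := by
    have h1 : ∀ᶠ z in 𝓝[≠] l, z ∉ L.lattice := by
      filter_upwards [self_mem_nhdsWithin, mem_nhdsWithin_of_mem_nhds
        (L.compl_lattice_sdiff_singleton_mem_nhds l)] with z hz hz' h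
      exact hz' ⟨h, hz⟩
    have h2 : ∀ᶠ z in 𝓝[≠] l, ρ * z ∉ L.lattice := by
      apply Filter.Eventually.filter_mono nhdsWithin_le_nhds
      have hc : ContinuousAt (fun z : ℂ ↦ ρ * z) l := by fun_prop
      exact hc.eventually (L.isClosed_lattice.isOpen_compl.mem_nhds hl')
    filter_upwards [h1, h2] with z hz1 hz2
    exact heq (fun h ↦ h.elim hz1 hz2)
  rw [meromorphicOrderAt_congr hev] at hmer
  have := (hganalytic l hl').meromorphicOrderAt_nonneg
  rw [hmer] at this
  exact absurd this (by decide)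

open scoped commutatorElement

/-! ### Finite groups of automorphisms of complex tori -/

theorem ofReal_mul_ω₁_mem_lattice_iff {r : ℝ} :
    (r : ℂ) * L.ω₁ ∈ L.lattice ↔ ∃ m : ℤ, (m : ℝ) = r := by
  constructor
  · intro h
    obtain ⟨m, n, hmn⟩ := mem_lattice.mp h
    have := LinearIndependent.pair_iff.mp L.indep (m - r) n
      (by simp; linear_combination hmn)
    exact ⟨m, sub_eq_zero.mp this.1⟩
  · rintro ⟨m, rfl⟩
    exact mem_lattice.mpr ⟨m, 0, by simp⟩

variable (L) in
theorem exists_translation_orderOf_eq (N : ℕ) (hN : N ≠ 0) :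
    ∃ t ∈ L.translations, orderOf t = N := by
  obtain ⟨t, ht⟩ := L.exists_translation (L.ω₁ / N)
  refine ⟨t, ⟨L.toTorus (L.ω₁ / N), fun s ↦ ?_⟩, ?_⟩
  · obtain ⟨z, rfl⟩ := L.toTorus_surjective s
    exact ht z
  have hpow (n : ℕ) (z : ℂ) : (t ^ n).1 (L.toTorus z) = L.toTorus (z + n * (L.ω₁ / N)) := by
    induction n generalizing z with
    | zero => rw [pow_zero, Nat.cast_zero, zero_mul, add_zero]; rfl
    | succ n ih =>
      rw [pow_succ, mul_apply, ht, ih]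
      congr 1
      push_cast
      ring
  have hN' : (N : ℂ) ≠ 0 := by exact_mod_cast hN
  have hN'' : (N : ℝ) ≠ 0 := by exact_mod_cast hN
  have hiff (n : ℕ) : t ^ n = 1 ↔ N ∣ n := by
    have h1 : t ^ n = 1 ↔ ((n / N : ℝ) : ℂ) * L.ω₁ ∈ L.lattice := by
      constructor
      · intro h
        have h2 := hpow n 0
        rw [h] at h2
        have h3 : L.toTorus 0 = L.toTorus (0 + n * (L.ω₁ / N)) := h2
        rw [toTorus_eq_iff] at h3
        convert h3 using 1
        push_cast
        ring
      · intro h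
        refine biholomorphisms_ext fun z ↦ ?_
        rw [hpow]
        change _ = L.toTorus z
        rw [toTorus_eq_iff']
        convert h using 1
        push_cast
        ring
    rw [h1, ofReal_mul_ω₁_mem_lattice_iff]
    constructor
    · rintro ⟨m, hm⟩
      rw [eq_div_iff hN''] at hm
      have hm' : m * (N : ℤ) = n := by exact_mod_cast hm
      exact Int.natCast_dvd_natCast.mp ⟨m, by rw [← hm', mul_comm]⟩
    · rintro ⟨k, rfl⟩
      refine ⟨k, ?_⟩
      push_cast
      field_simp
  exact Nat.dvd_antisymm (orderOf_dvd_iff_pow_eq_one.mpr ((hiff N).mpr dvd_rfl))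
    ((hiff _).mp (pow_orderOf_eq_one t))

theorem embedsIn_zmod (N : ℕ) (hN : 1 ≤ N) :
    EmbedsIn (Multiplicative (ZMod N)) (Biholomorphisms L.Torus) := by
  obtain ⟨t, -, ht⟩ := L.exists_translation_orderOf_eq N (by omega)
  have e := zmodCyclicMulEquiv (G := Subgroup.zpowers t) inferInstance
  rw [Nat.card_zpowers, ht] at e
  exact e.embedsIn ((Subgroup.zpowers t).subtype.embedsIn Subtype.val_injective)

theorem neg_conj_translation {s c : Biholomorphisms L.Torus}
    (hs : ∀ z, s.1 (L.toTorus z) = L.toTorus (-z)) (hc : c ∈ L.translations) :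
    s * c * s⁻¹ = c⁻¹ := by
  rw [mul_inv_eq_iff_eq_mul, eq_inv_mul_iff_mul_eq]
  obtain ⟨a', ha⟩ := hc
  obtain ⟨a, rfl⟩ := L.toTorus_surjective a'
  refine biholomorphisms_ext fun z ↦ ?_
  rw [mul_apply, mul_apply, ha (L.toTorus z), ← toTorus_add, hs, ha, ← toTorus_add, hs]
  congr 1
  ring

theorem linearPart_neg {s : Biholomorphisms L.Torus}
    (hs : ∀ z, s.1 (L.toTorus z) = L.toTorus (-z)) : (L.linearPart s : ℂ) = -1 :=
  linearPart_eq (b := 0) fun z ↦ by rw [hs, neg_one_mul, add_zero]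

theorem embedsIn_dihedral (N : ℕ) (hN : 1 ≤ N) :
    EmbedsIn (DihedralGroup N) (Biholomorphisms L.Torus) := by
  obtain ⟨t, ht, htN⟩ := L.exists_translation_orderOf_eq N (by omega)
  obtain ⟨s, hs⟩ := L.exists_neg
  have hle : Subgroup.zpowers t ≤ L.translations := by simpa using ht
  have : Finite (Subgroup.zpowers t) :=
    Nat.finite_of_card_ne_zero (by rw [Nat.card_zpowers, htN]; omega)
  have h := exists_dihedral_hom_injective (Subgroup.zpowers t) inferInstance (s := s) ?_
    (mul_self_of_linearPart_eq_neg_one (linearPart_neg hs))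
    (fun c hc ↦ neg_conj_translation hs (hle hc))
  · rwa [Nat.card_zpowers, htN] at h
  · intro h0
    have h1 := linearPart_neg hs
    rw [linearPart_eq_one_iff.mpr (hle h0), Units.val_one] at h1
    norm_num at h1

theorem exists_cube_root : ∃ ρ : ℂ, ρ ^ 2 + ρ + 1 = 0 := by
  obtain ⟨s, hs⟩ := IsAlgClosed.exists_eq_mul_self (-3 : ℂ)
  exact ⟨(-1 + s) / 2, by linear_combination -hs / 4⟩

theorem embedsIn_alternatingGroup (hg : L.g₂ = 0) :
    EmbedsIn (alternatingGroup (Fin 4)) (Biholomorphisms L.Torus) := by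
  obtain ⟨ρ, hρ⟩ := exists_cube_root
  have hlin := mul_mem_lattice_of_g₂_eq_zero hg hρ
  have h3 : ρ * ρ ^ 2 = 1 := by linear_combination (ρ - 1) * hρ
  obtain ⟨g, hgz⟩ := exists_biholomorphism (L := L) h3 hlin (fun l hl ↦ by
    rw [pow_two, mul_assoc]
    exact hlin _ (hlin _ hl)) 0
  obtain ⟨a, ha⟩ := L.exists_translation (L.ω₁ / 2)
  obtain ⟨b, hb⟩ := L.exists_translation (ρ * (L.ω₁ / 2))
  have hω := L.ω₁_mem_lattice
  have hone (z : ℂ) : (1 : Biholomorphisms L.Torus).1 (L.toTorus z) = L.toTorus z := rfl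
  refine embedsIn_alternatingGroup_four (a := a) (b := b) (g := g) ?_ ?_ ?_ ?_ ?_ ?_ ?_
  · refine biholomorphisms_ext fun z ↦ ?_
    rw [mul_apply, ha, ha, hone, toTorus_eq_iff']
    convert hω using 1
    ring
  · rintro rfl
    have := (hone 0).symm.trans (ha 0)
    rw [toTorus_eq_iff] at this
    exact L.ω₁_div_two_notMem_lattice (by simpa using this)
  · rintro rfl
    have h1 := (ha 0).symm.trans (hb 0)
    rw [toTorus_eq_iff'] at h1
    apply L.ω₁_div_two_notMem_lattice
    -- If the two half-periods agreed modulo the lattice, `(2 + ρ)(1 - ρ) = 3` would put `3ω₁/2`,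
    -- hence `ω₁/2`, in the lattice.
    have h4 := sub_mem (add_mem (add_mem h1 h1) (hlin _ h1)) hω
    convert h4 using 1
    linear_combination (L.ω₁ / 2) * hρ
  · refine biholomorphisms_ext fun z ↦ ?_
    rw [mul_apply, mul_apply, hb, ha, ha, hb]
    congr 1
    ring
  · apply pow_three_of_linearPart
    rw [linearPart_eq hgz]
    exact hρ
  · rw [mul_inv_eq_iff_eq_mul]
    refine biholomorphisms_ext fun z ↦ ?_
    rw [mul_apply, mul_apply, ha, hgz, hgz, hb]
    congr 1
    ring
  · rw [mul_inv_eq_iff_eq_mul]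
    refine biholomorphisms_ext fun z ↦ ?_
    rw [mul_apply, mul_apply, mul_apply, hb, hgz, hgz, hb, ha, toTorus_eq_iff']
    convert hlin _ (hlin _ hω) using 1
    -- The translation parts `ρ²ω₁/2` and `(1 + ρ)ω₁/2` differ by the lattice vector `ρ²ω₁`.
    linear_combination (-L.ω₁ / 2) * hρ

section FiniteGroups

variable {G : Type*} [Group G] {β : G →* Biholomorphisms L.Torus}

theorem ker_linearPart_comm (hβ : Function.Injective β) {x y : G}
    (hx : x ∈ (L.linearPart.comp β).ker) (hy : y ∈ (L.linearPart.comp β).ker) :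
    x * y = y * x := by
  apply hβ
  rw [map_mul, map_mul]
  exact translations_comm (linearPart_eq_one_iff.mp hx) (linearPart_eq_one_iff.mp hy)

/-- The linear part has abelian target and abelian kernel, so commutators are translations and
commute with each other. -/
theorem commutator_commute (hβ : Function.Injective β) (x y z w : G) :
    ⁅x, y⁆ * ⁅z, w⁆ = ⁅z, w⁆ * ⁅x, y⁆ := by
  have h (x y : G) : ⁅x, y⁆ ∈ (L.linearPart.comp β).ker := by
    rw [MonoidHom.mem_ker, map_commutatorElement, commutatorElement_eq_one_iff_mul_comm, mul_comm]
  exact ker_linearPart_comm hβ (h x y) (h z w)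

theorem linearPart_cases [Finite G] (β : G →* Biholomorphisms L.Torus) (g : G) :
    (L.linearPart (β g) : ℂ) = 1 ∨ (L.linearPart (β g) : ℂ) = -1 ∨
      (L.linearPart (β g) : ℂ) ^ 2 + 1 = 0 ∨
      (L.linearPart (β g) : ℂ) ^ 2 + L.linearPart (β g) + 1 = 0 ∨
      (L.linearPart (β g) : ℂ) ^ 2 - L.linearPart (β g) + 1 = 0 := by
  refine lattice_multiplier_cases (L := L) (fun l hl ↦ mul_mem_lattice _ hl) ?_
  obtain ⟨n, hn, h⟩ := isOfFinOrder_iff_pow_eq_one.mp (isOfFinOrder_of_finite g)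
  refine Complex.norm_eq_one_of_pow_eq_one (n := n) ?_ hn.ne'
  rw [← Units.val_pow_eq_pow_val, ← map_pow, ← map_pow, h, map_one, map_one, Units.val_one]

/-- A finite group of torus automorphisms with at most two translations is abelian. -/
theorem comm_of_card_ker_le_two [Finite G] (ℓ : G →* ℂˣ) (hA : Nat.card ℓ.ker ≤ 2) (x y : G) :
    x * y = y * x := by
  have : Finite ℓ.range := Finite.of_surjective _ ℓ.rangeRestrict_surjective
  have : IsCyclic ℓ.range := isCyclic_of_injective_ringHom
    ((Units.coeHom ℂ).comp ℓ.range.subtype) (Units.val_injective.comp Subtype.val_injective)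
  -- The quotient by the kernel is cyclic, so a central kernel suffices. Conjugation fixes the only
  -- possible nontrivial element of a normal subgroup of order at most 2.
  suffices h : ℓ.rangeRestrict.ker ≤ Subgroup.center G from
    (MonoidHom.isMulCommutative_of_isCyclic_of_ker_le_center ℓ.rangeRestrict h).is_comm.comm x y
  rw [MonoidHom.ker_rangeRestrict]
  intro a ha
  rw [Subgroup.mem_center_iff]
  intro g
  have hconj : g * a * g⁻¹ ∈ ℓ.ker := ℓ.normal_ker.conj_mem a ha g
  by_cases ha1 : a = 1
  · rw [ha1, one_mul, mul_one]
  have hc1 : g * a * g⁻¹ ≠ 1 := fun h ↦ ha1 (conj_eq_one_iff.mp h)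
  by_contra hne
  have hne' : g * a * g⁻¹ ≠ a := fun h ↦ hne (by rw [← mul_inv_eq_iff_eq_mul, h])
  have hsub : ({1, a, g * a * g⁻¹} : Set G) ⊆ (ℓ.ker : Set G) := by
    rintro z (rfl | rfl | rfl)
    exacts [ℓ.ker.one_mem, ha, hconj]
  have h3 : ({1, a, g * a * g⁻¹} : Set G).ncard = 3 := by
    rw [Set.ncard_insert_of_notMem (by simp [Ne.symm ha1, Ne.symm hc1]),
      Set.ncard_pair (Ne.symm hne')]
  have h4 := Set.ncard_le_ncard hsub (Set.toFinite _)
  have h5 : (ℓ.ker : Set G).ncard = Nat.card ℓ.ker := rfl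
  omega

end FiniteGroups

theorem alternatingGroup_or_isCyclicOrDihedral {G : Type*} [Group G] [Finite G] {α : G →* AutSl2}
    (hα : Function.Injective α) {β : G →* Biholomorphisms L.Torus} (hβ : Function.Injective β) :
    IsCyclicOrDihedral G ∨ (Nonempty (G ≃* alternatingGroup (Fin 4)) ∧ L.g₂ = 0) := by
  set ℓ := L.linearPart.comp β with hℓ
  set A := ℓ.ker with hA
  by_cases hA2 : ∃ b ∈ A, b * b ≠ 1
  · obtain ⟨b, hb, hb2⟩ := hA2
    exact .inl (Sl2.isCyclicOrDihedral_of_normal hα A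
      (fun x hx y hy ↦ ker_linearPart_comm hβ hx hy) hb hb2)
  push Not at hA2
  by_cases hcomm : ∀ x y : G, x * y = y * x
  · exact .inl (Sl2.isCyclicOrDihedral_of_comm hα hcomm)
  have hA3 : ¬ Nat.card A ≤ 2 := fun h ↦ hcomm (comm_of_card_ker_le_two ℓ h)
  have hA4 : Nat.card A = 4 := by
    have hle : Nat.card A ≤ 4 := Sl2.card_le_four (α := α.comp A.subtype)
      (hα.comp Subtype.val_injective) (fun x ↦ Subtype.ext (hA2 x x.2))
    have : Nontrivial A := Finite.one_lt_card_iff_nontrivial.mp (by omega)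
    obtain ⟨a, ha⟩ := exists_ne (1 : A)
    have h2 : orderOf a = 2 := by
      have : Fact (Nat.Prime 2) := ⟨Nat.prime_two⟩
      exact orderOf_eq_prime (by rw [pow_two]; exact Subtype.ext (hA2 a a.2)) ha
    have h3 := orderOf_dvd_natCard a
    rw [h2] at h3
    omega
  have hneg (g : G) : (ℓ g : ℂ) ≠ -1 := by
    intro hg
    -- Elements with linear part `-1` are involutions, so the preimage `K` of `{1, -1}` has exponent
    -- dividing 2 and order at most 4; then it equals `A`.
    set K := (Subgroup.zpowers (-1 : ℂˣ)).comap ℓ with hK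
    have hgK : g ∈ K := by
      have : ℓ g = -1 := Units.ext (by simpa using hg)
      rw [hK, Subgroup.mem_comap, this]
      exact Subgroup.mem_zpowers _
    have hK2 (x : K) : x * x = 1 := by
      have hx : (ℓ x) ^ 2 = 1 := by
        obtain ⟨n, hn⟩ := x.2
        simp only at hn
        rw [← hn, ← zpow_natCast, ← zpow_mul, mul_comm, zpow_mul]
        simp
      have hx' : (ℓ x : ℂ) * ℓ x = 1 := by
        rw [← pow_two, ← Units.val_pow_eq_pow_val, hx, Units.val_one]
      apply Subtype.ext
      rcases mul_self_eq_one_iff.mp hx' with h | h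
      · exact hA2 _ (Units.ext h)
      · apply hβ
        rw [Subgroup.coe_mul, map_mul, Subgroup.coe_one, map_one]
        exact mul_self_of_linearPart_eq_neg_one h
    have hKle : Nat.card K ≤ 4 := Sl2.card_le_four (α := α.comp K.subtype)
      (hα.comp Subtype.val_injective) hK2
    have hAK : A ≤ K := fun x hx ↦ by
      rw [hK, Subgroup.mem_comap, show ℓ x = 1 from hx]
      exact one_mem _
    have heq : A = K := Subgroup.eq_of_le_of_card_ge hAK (by omega)
    rw [← heq] at hgK
    rw [show ℓ g = 1 from hgK, Units.val_one] at hg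
    norm_num at hg
  have hcases (g : G) : (ℓ g : ℂ) = 1 ∨ (ℓ g : ℂ) ^ 2 + ℓ g + 1 = 0 := by
    rcases linearPart_cases β g with h | h | h | h | h
    · exact .inl h
    · exact absurd h (hneg g)
    -- Linear parts of order 4 or 6 have `-1` as their square or cube.
    · refine absurd ?_ (hneg (g ^ 2))
      rw [map_pow, Units.val_pow_eq_pow_val]
      linear_combination h
    · exact .inr h
    · refine absurd ?_ (hneg (g ^ 3))
      rw [map_pow, Units.val_pow_eq_pow_val]
      change (L.linearPart (β g) : ℂ) ^ 3 = -1
      linear_combination (L.linearPart (β g) + 1 : ℂ) * h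
  obtain ⟨g, hg⟩ : ∃ g : G, (ℓ g : ℂ) ^ 2 + ℓ g + 1 = 0 := by
    by_contra! h
    have hker (x : G) : x ∈ A := Units.ext ((hcases x).resolve_right (h x))
    exact hcomm fun x y ↦ ker_linearPart_comm hβ (hker x) (hker y)
  have : Fact (Nat.Prime 3) := ⟨Nat.prime_three⟩
  have hℓ3 : orderOf (ℓ g) = 3 := by
    refine orderOf_eq_prime (Units.ext ?_) ?_
    · rw [Units.val_pow_eq_pow_val, Units.val_one]
      linear_combination ((ℓ g : ℂ) - 1) * hg
    · intro h
      rw [h, Units.val_one] at hg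
      norm_num at hg
  have hg3 : orderOf g = 3 := by
    refine orderOf_eq_prime (hβ ?_) ?_
    · rw [map_pow, map_one]
      exact pow_three_of_linearPart hg
    · rintro rfl
      rw [map_one, orderOf_one] at hℓ3
      norm_num at hℓ3
  have hrange : ℓ.range = Subgroup.zpowers (ℓ g) := by
    refine le_antisymm ?_ (by simp)
    rintro _ ⟨x, rfl⟩
    rcases hcases x with h | h
    · rw [show ℓ x = 1 from Units.ext h]
      exact one_mem _
    · have h1 : ((ℓ x : ℂ) - ℓ g) * (ℓ x - (ℓ g : ℂ) ^ 2) = 0 := by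
        linear_combination h + ((ℓ g : ℂ) - 1 - ℓ x) * hg
      rcases mul_eq_zero.mp h1 with h2 | h2
      · rw [show ℓ x = ℓ g from Units.ext (sub_eq_zero.mp h2)]
        exact Subgroup.mem_zpowers _
      · rw [show ℓ x = ℓ g ^ 2 from Units.ext (by simpa using sub_eq_zero.mp h2)]
        exact pow_mem (Subgroup.mem_zpowers _) 2
  have hcard : Nat.card G = 12 := by
    rw [← A.card_mul_index, hA4, hA, Subgroup.index_ker, hrange, Nat.card_zpowers, hℓ3]
  set P := Subgroup.zpowers g
  have hP : Nat.card P = 3 := by rw [Nat.card_zpowers, hg3]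
  refine .inr ⟨nonempty_mulEquiv_alternatingGroup_four hcard P hP ?_,
    g₂_eq_zero hg fun l hl ↦ mul_mem_lattice _ hl⟩
  intro hn
  -- If `P` were normal, it would commute with `A`, but `g` commutes with no translation of order 2.
  have hdisj : Disjoint P A := Subgroup.disjoint_of_coprime_natCard (by rw [hP, hA4]; decide)
  have : Nontrivial A := Finite.one_lt_card_iff_nontrivial.mp (by omega)
  obtain ⟨a, ha⟩ := exists_ne (1 : A)
  have hga : g * a = a * g :=
    Subgroup.commute_of_normal_of_disjoint P A hn ℓ.normal_ker hdisj g a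
      (Subgroup.mem_zpowers g) a.2
  have ha1 : β a = 1 := eq_one_of_commute hg (linearPart_eq_one_iff.mp a.2)
    (by rw [← map_mul, hA2 a a.2, map_one]) (by rw [← map_mul, ← map_mul, hga])
  exact ha (Subtype.ext (hβ (ha1.trans (map_one β).symm)))

/-! ### The commutator subgroup and the excluded groups -/

/-- The commutator subgroup of the automorphism group of a torus consists of the translations. -/
theorem commutator_eq_translations : commutator (Biholomorphisms L.Torus) = L.translations := by
  apply le_antisymm
  · intro f hf
    exact linearPart_eq_one_iff.mp (Abelianization.commutator_subset_ker L.linearPart hf)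
  · rintro f ⟨a', ha⟩
    obtain ⟨a, rfl⟩ := L.toTorus_surjective a'
    -- Negation `s` inverts translations, so `⁅s, t⁆ = t⁻²`; this is translation by `a`.
    obtain ⟨t, ht⟩ := L.exists_translation (-a / 2)
    obtain ⟨u, hu⟩ := L.exists_translation (a / 2)
    obtain ⟨s, hs⟩ := L.exists_neg
    have htT : t ∈ L.translations := ⟨L.toTorus (-a / 2), fun r ↦ by
      obtain ⟨z, rfl⟩ := L.toTorus_surjective r
      exact ht z⟩
    have htu : t⁻¹ = u := by
      refine inv_eq_of_mul_eq_one_right (biholomorphisms_ext fun z ↦ ?_)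
      rw [mul_apply, hu, ht]
      change _ = L.toTorus z
      congr 1
      ring
    have hf : f = ⁅s, t⁆ := by
      rw [commutatorElement_def, neg_conj_translation hs htT, htu]
      refine biholomorphisms_ext fun z ↦ ?_
      rw [ha, mul_apply, hu, hu, ← toTorus_add]
      congr 1
      ring
    rw [hf]
    exact Subgroup.commutator_mem_commutator (Subgroup.mem_top s) (Subgroup.mem_top t)

theorem not_embedsIn_perm_four : ¬ EmbedsIn (Equiv.Perm (Fin 4)) (Biholomorphisms L.Torus) := by
  rintro ⟨φ, hφ⟩
  -- These commutators are 3-cycles on `{0, 1, 2}` and `{0, 1, 3}`, which do not commute.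
  have := commutator_commute hφ (Equiv.swap 0 1) (Equiv.swap 1 2) (Equiv.swap 0 1) (Equiv.swap 1 3)
  revert this
  decide

theorem not_embedsIn_alternatingGroup_five :
    ¬ EmbedsIn (alternatingGroup (Fin 5)) (Biholomorphisms L.Torus) := by
  rintro ⟨φ, hφ⟩
  -- The four elements are 3-cycles chosen so that the two commutators fail to commute.
  have := commutator_commute hφ ⟨Equiv.swap 0 1 * Equiv.swap 1 2, Equiv.Perm.mem_alternatingGroup.mpr (by decide)⟩
    ⟨Equiv.swap 0 3 * Equiv.swap 3 4, Equiv.Perm.mem_alternatingGroup.mpr (by decide)⟩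
    ⟨Equiv.swap 0 1 * Equiv.swap 1 3, Equiv.Perm.mem_alternatingGroup.mpr (by decide)⟩
    ⟨Equiv.swap 0 2 * Equiv.swap 2 4, Equiv.Perm.mem_alternatingGroup.mpr (by decide)⟩
  have h := congrArg Subtype.val this
  revert h
  decide

end PeriodPair

end

theorem mainTheorem8 (L : PeriodPair) :
    (∀ (G : Type*) [Group G] [Finite G],
      (EmbedsIn G AutSl2 ∧ EmbedsIn G (Biholomorphisms L.Torus)) ↔
        (∃ N : ℕ, 1 ≤ N ∧ Nonempty (G ≃* Multiplicative (ZMod N))) ∨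
        (∃ N : ℕ, 2 ≤ N ∧ Nonempty (G ≃* DihedralGroup N)) ∨
        (Nonempty (G ≃* alternatingGroup (Fin 4)) ∧ L.g₂ = 0)) ∧
    ¬ EmbedsIn (Equiv.Perm (Fin 4)) (Biholomorphisms L.Torus) ∧
    ¬ EmbedsIn (alternatingGroup (Fin 5)) (Biholomorphisms L.Torus) ∧
    commutator (Biholomorphisms L.Torus) = L.translations := by
  refine ⟨fun G _ _ ↦ ⟨?_, ?_⟩, PeriodPair.not_embedsIn_perm_four,
    PeriodPair.not_embedsIn_alternatingGroup_five, PeriodPair.commutator_eq_translations⟩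
  · rintro ⟨⟨α, hα⟩, ⟨β, hβ⟩⟩
    exact or_assoc.mp (PeriodPair.alternatingGroup_or_isCyclicOrDihedral hα hβ)
  · rintro (⟨N, hN, ⟨e⟩⟩ | ⟨N, hN, ⟨e⟩⟩ | ⟨⟨e⟩, hg⟩)
    · exact ⟨e.embedsIn (Sl2.embedsIn_zmod N hN), e.embedsIn (PeriodPair.embedsIn_zmod N hN)⟩
    · exact ⟨e.embedsIn (Sl2.embedsIn_dihedral N (by omega)),
        e.embedsIn (PeriodPair.embedsIn_dihedral N (by omega))⟩
    · exact ⟨e.embedsIn Sl2.embedsIn_alternatingGroup,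
        e.embedsIn (PeriodPair.embedsIn_alternatingGroup hg)⟩
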